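/- **Setting.** Let $n\ge 1$, $1\le p\le\infty$, $0<T\le\infty$ and $\mathbf R^n_T=\{(X,t)\in\mathbf R^{n}\times\mathbf R : 0<t<T\}$. The Fourier transform is $\hat g(\xi)=\int_{\mathbf R^n} e^{-2\pi i x\cdot\xi}g(x)\,dx$. Fix $\phi,\psi\in\mathcal S(\mathbf R^n)$ such that $\hat\phi>0$ on $\{\frac12<|\xi|<2\}$, $\hat\phi=0$ elsewhere, $\sum_{j\in\mathbf Z}\hat\phi(2^{-j}\xi)=1$ for $\xi\ne0$, and $\hat\psi(\xi)=1-\sum_{j\ge1}\hat\phi(2^{-j}\xi)$; let $\hat\phi_j(\xi)=\hat\phi(2^{-j}\xi)$. For $\alpha\in\mathbf R$, the Besov space $\mathcal B^\alpha_p(\mathbf R^n)$ consists of the complex tempered distributions $f$ on $\mathbf R^n$ with $\|f\|_{\mathcal B^\alpha_p}<\infty$, where $$\|f\|_{\mathcal B^\alpha_p}=\|\psi*f\|_{L^p}+\Big(\sum_{j\ge1}\big(2^{\alpha j}\|\phi_j*f\|_{L^p}\big)^p\Big)^{1/p}\quad(p<\infty),\qquad \|f\|_{\mathcal B^\alpha_\infty}=\sup\big\{\|\psi*f\|_{L^\infty},\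 2^{\alpha j}\|\phi_j*f\|_{L^\infty}: j\ge1\big\}.$$ For an integer $i\ge0$, $\|v\|_{W^{2i,i}_p(\mathbf R^n_T)}$ is $\big(\sum_{|\beta|+2l\le2i}\|D_X^\beta D_t^l v\|_{L^p(\mathbf R^n_T)}^p\big)^{1/p}$ for $p<\infty$ and $\sum_{|\beta|+2l\le 2i}\|D_X^\beta D_t^l v\|_{L^\infty(\mathbf R^n_T)}$ for $p=\infty$ (weak derivatives; the value is $\infty$ if $v\notin W^{2i,i}_p(\mathbf R^n_T)$). For a tempered distribution $f$ its caloric extension is $u(X,t)=\langle f,\Gamma(X-\cdot,t)\rangle$, $t>0$, where $\Gamma(X,t)=(4\pi t)^{-n/2}e^{-|X|^2/(4t)}$. **Theorem.** There is a constant $C>0$ depending only on $n,p,T$ (and on the fixed pair $\phi,\psi$) such that for every integer $i\ge0$ and every $f\in\mathcal B^{2i-2/p}_p(\mathbf R^n)$ (with $2/\infty=0$), with $u$ its caloric extension, $$\|f\|_{\mathcal B^{2i-2/p}_p(\mathbf R^n)}\le C\,\|u\|_{W^{2i,i}_p(\mathbf R^n_T)}.$$ -/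

import Mathlib

open MeasureTheory SchwartzMap
open scoped ENNReal NNReal FourierTransform ContDiff

noncomputable section

/-- Euclidean space `ℝⁿ`. -/
abbrev Rn (n : ℕ) : Type := EuclideanSpace ℝ (Fin n)

/-! ### The heat kernel -/

theorem gaussian_decay {n : ℕ} (s : ℝ) (hs : 0 < s) (k m : ℕ) :
    ∃ C : ℝ, ∀ x : Rn n,
      ‖x‖ ^ k * ‖iteratedFDeriv ℝ m (fun x : Rn n => Real.exp (-s * ‖x‖ ^ 2)) x‖ ≤ C := by
  have hq : (fun x : Rn n => -s * ‖x‖ ^ 2).HasTemperateGrowth :=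
    (Function.HasTemperateGrowth.const (-s)).mul (Function.hasTemperateGrowth_norm_sq (Rn n))
  obtain ⟨N, C, hC, hbd⟩ := hq.norm_iteratedFDeriv_le_uniform m
  have key : ∀ x : Rn n,
      ‖iteratedFDeriv ℝ m (fun x : Rn n => Real.exp (-s * ‖x‖ ^ 2)) x‖
        ≤ m.factorial * Real.exp (-s * ‖x‖ ^ 2) * ((C + 1) * (1 + ‖x‖) ^ N) ^ m := by
    intro x
    have h1 : (1 : ℝ) ≤ (1 + ‖x‖) ^ N := one_le_pow₀ (by linarith [norm_nonneg x])
    refine norm_iteratedFDeriv_comp_le (𝕜 := ℝ) (g := Real.exp)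
      (f := fun x : Rn n => -s * ‖x‖ ^ 2) (n := m) (N := ∞)
      (Real.contDiff_exp) hq.1 (by exact_mod_cast le_top) x ?_ ?_
    · intro i _
      rw [norm_iteratedFDeriv_eq_norm_iteratedDeriv, iteratedDeriv_eq_iterate,
        Real.iter_deriv_exp, Real.norm_eq_abs, abs_of_pos (Real.exp_pos _)]
    · intro i hi him
      have h2 : (1 : ℝ) ≤ (C + 1) * (1 + ‖x‖) ^ N := by nlinarith
      calc _ ≤ C * (1 + ‖x‖) ^ N := hbd i him x
        _ ≤ (C + 1) * (1 + ‖x‖) ^ N := by nlinarith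
        _ ≤ _ := le_self_pow₀ h2 (by omega)
  -- a polynomial times a Gaussian is bounded
  have hlim : Filter.Tendsto (fun r : ℝ => (1 + r) ^ (k + N * m) * Real.exp (-s * r))
      Filter.atTop (nhds 0) := by
    have h0 := (Real.tendsto_pow_mul_exp_neg_atTop_nhds_zero (k + N * m)).comp
      (Filter.Tendsto.const_mul_atTop hs (Filter.tendsto_atTop_add_const_left _ (1 : ℝ)
        Filter.tendsto_id))
    have h3 := h0.const_mul ((s⁻¹) ^ (k + N * m) * Real.exp s)
    simp only [mul_zero] at h3
    refine h3.congr fun r => ?_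
    simp only [Function.comp, id]
    rw [mul_pow, show -s * r = -(s * (1 + r)) + s by ring, Real.exp_add, inv_pow]
    field_simp
  have hcont : Continuous (fun r : ℝ => (1 + r) ^ (k + N * m) * Real.exp (-s * r)) := by fun_prop
  obtain ⟨R, hR⟩ := Filter.eventually_atTop.1 (hlim.eventually (gt_mem_nhds zero_lt_one))
  obtain ⟨M, hM⟩ := (isCompact_Icc (a := (0 : ℝ)) (b := R)).bddAbove_image hcont.continuousOn
  have hb : ∀ r : ℝ, 0 ≤ r → (1 + r) ^ (k + N * m) * Real.exp (-s * r) ≤ max M 1 := by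
    intro r hr
    by_cases h : r ≤ R
    · exact le_max_of_le_left (hM ⟨r, ⟨hr, h⟩, rfl⟩)
    · exact le_max_of_le_right (hR r (le_of_not_ge h)).le
  refine ⟨m.factorial * (C + 1) ^ m * Real.exp (s / 4) * max M 1, fun x => ?_⟩
  have hx := norm_nonneg x
  have hexp : Real.exp (-s * ‖x‖ ^ 2) ≤ Real.exp (s / 4) * Real.exp (-s * ‖x‖) := by
    rw [← Real.exp_add]
    exact Real.exp_le_exp.2 (by nlinarith [mul_nonneg hs.le (sq_nonneg (‖x‖ - 1 / 2))])
  calc ‖x‖ ^ k * ‖iteratedFDeriv ℝ m (fun x : Rn n => Real.exp (-s * ‖x‖ ^ 2)) x‖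
      ≤ (1 + ‖x‖) ^ k * (m.factorial * (Real.exp (s / 4) * Real.exp (-s * ‖x‖))
          * ((C + 1) * (1 + ‖x‖) ^ N) ^ m) := by
        refine mul_le_mul (pow_le_pow_left₀ hx (by linarith) k) ((key x).trans ?_)
          (norm_nonneg _) (by positivity)
        gcongr
    _ = m.factorial * (C + 1) ^ m * Real.exp (s / 4)
          * ((1 + ‖x‖) ^ (k + N * m) * Real.exp (-s * ‖x‖)) := by
        rw [mul_pow, pow_add, pow_mul]; ring
    _ ≤ _ := by
        have := hb ‖x‖ hx
        gcongr

/-- The function `x ↦ exp (-s ‖x‖²)`, `s > 0`, as a Schwartz function. -/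
def gaussianSchwartz (n : ℕ) (s : ℝ) (hs : 0 < s) : 𝓢(Rn n, ℝ) where
  toFun x := Real.exp (-s * ‖x‖ ^ 2)
  smooth' := by
    have h : ContDiff ℝ ∞ (fun x : Rn n => ‖x‖ ^ 2) := contDiff_norm_sq ℝ
    exact Real.contDiff_exp.comp (contDiff_const.mul h)
  decay' k m := gaussian_decay s hs k m

/-- The heat kernel `Γ(·, t)`, equal to `(4πt)^(-n/2) exp (-‖x‖² / (4t))` for `t > 0` and to `0`
otherwise, as a Schwartz function of `x`. -/
def heatKernel (n : ℕ) (t : ℝ) : 𝓢(Rn n, ℂ) :=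
  if ht : 0 < t then
    (4 * Real.pi * t) ^ (-(n : ℝ) / 2) •
      (gaussianSchwartz n (4 * t)⁻¹ (by positivity)).postcompCLM Complex.ofRealCLM
  else 0

theorem heatKernel_apply (n : ℕ) {t : ℝ} (ht : 0 < t) (x : Rn n) :
    heatKernel n t x
      = (((4 * Real.pi * t) ^ (-(n : ℝ) / 2) * Real.exp (-‖x‖ ^ 2 / (4 * t)) : ℝ) : ℂ) := by
  have h : -‖x‖ ^ 2 / (4 * t) = -(4 * t)⁻¹ * ‖x‖ ^ 2 := by ring
  rw [heatKernel, dif_pos ht, h, Complex.ofReal_mul]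
  rfl

/-! ### Convolution with a tempered distribution and the caloric extension -/

/-- For a Schwartz function `g` and a point `x`, the Schwartz function `y ↦ g (x - y)`. -/
def reflectAt {n : ℕ} (g : 𝓢(Rn n, ℂ)) (x : Rn n) : 𝓢(Rn n, ℂ) :=
  compSubConstCLM ℂ x (compCLMOfContinuousLinearEquiv ℂ (ContinuousLinearEquiv.neg ℝ) g)

theorem reflectAt_apply {n : ℕ} (g : 𝓢(Rn n, ℂ)) (x y : Rn n) :
    reflectAt g x y = g (x - y) := by
  simp [reflectAt]

/-- The convolution `(g * f)(x) = ⟨f, g (x - ·)⟩` of a tempered distribution `f` with a Schwartz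
function `g`, a function on `ℝⁿ`. -/
def convDist {n : ℕ} (g : 𝓢(Rn n, ℂ)) (f : 𝓢'(Rn n, ℂ)) (x : Rn n) : ℂ :=
  f (reflectAt g x)

/-- The caloric extension `u(x, t) = ⟨f, Γ(x - ·, t)⟩`. -/
def caloricExtension {n : ℕ} (f : 𝓢'(Rn n, ℂ)) (z : Rn n × ℝ) : ℂ :=
  convDist (heatKernel n z.2) f z.1

/-! ### Besov spaces on `ℝⁿ` -/

/-- A dyadic resolution of unity: `φ̂ > 0` on `1/2 < |ξ| < 2`, `φ̂ = 0` elsewhere,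
`∑_{j ∈ ℤ} φ̂(2⁻ʲ ξ) = 1` for `ξ ≠ 0`, and `ψ̂(ξ) = 1 - ∑_{j ≥ 1} φ̂(2⁻ʲ ξ)`. -/
structure IsDyadicResolution {n : ℕ} (φ ψ : 𝓢(Rn n, ℂ)) : Prop where
  pos : ∀ ξ : Rn n, 2⁻¹ < ‖ξ‖ → ‖ξ‖ < 2 → (𝓕 φ ξ).im = 0 ∧ 0 < (𝓕 φ ξ).re
  eq_zero : ∀ ξ : Rn n, ¬ (2⁻¹ < ‖ξ‖ ∧ ‖ξ‖ < 2) → 𝓕 φ ξ = 0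
  hasSum : ∀ ξ : Rn n, ξ ≠ 0 → HasSum (fun j : ℤ => 𝓕 φ ((2 : ℝ) ^ (-j) • ξ)) 1
  low : ∀ ξ : Rn n, 𝓕 ψ ξ = 1 - ∑' j : ℕ, 𝓕 φ ((2 : ℝ) ^ (-((j : ℤ) + 1)) • ξ)

/-- The Schwartz function `φ_j` with `φ̂_j(ξ) = φ̂(2⁻ʲ ξ)`. -/
def dyadicPiece {n : ℕ} (φ : 𝓢(Rn n, ℂ)) (j : ℕ) : 𝓢(Rn n, ℂ) :=
  𝓕⁻ (compCLMOfContinuousLinearEquiv ℂ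
    (ContinuousLinearEquiv.smulLeft (R₁ := ℝ) (M₁ := Rn n)
      (Units.mk0 ((2 : ℝ) ^ (-(j : ℤ))) (by positivity))) (𝓕 φ))

theorem fourier_dyadicPiece {n : ℕ} (φ : 𝓢(Rn n, ℂ)) (j : ℕ) (ξ : Rn n) :
    𝓕 (dyadicPiece φ j) ξ = 𝓕 φ ((2 : ℝ) ^ (-(j : ℤ)) • ξ) := by
  simp [dyadicPiece, Units.smul_def]

/-- The norm of the Besov space `B^α_p(ℝⁿ) = B^α_{pp}(ℝⁿ)` on tempered distributions
(`f` belongs to the space iff its norm is finite):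
`‖ψ * f‖_p + (∑_{j ≥ 1} (2^{αj} ‖φ_j * f‖_p)^p)^{1/p}` for `p < ∞`, and
`sup (‖ψ * f‖_∞, 2^{αj} ‖φ_j * f‖_∞)` for `p = ∞`. -/
def besovNorm {n : ℕ} (φ ψ : 𝓢(Rn n, ℂ)) (α : ℝ) (p : ℝ≥0∞) (f : 𝓢'(Rn n, ℂ)) : ℝ≥0∞ :=
  if p = ⊤ then
    max (eLpNorm (convDist ψ f) ⊤ volume)
      (⨆ j : ℕ, (2 : ℝ≥0∞) ^ (α * ((j : ℝ) + 1)) *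
        eLpNorm (convDist (dyadicPiece φ (j + 1)) f) ⊤ volume)
  else
    eLpNorm (convDist ψ f) p volume +
      (∑' j : ℕ, ((2 : ℝ≥0∞) ^ (α * ((j : ℝ) + 1)) *
        eLpNorm (convDist (dyadicPiece φ (j + 1)) f) p volume) ^ p.toReal) ^ (1 / p.toReal)

/-! ### Parabolic Sobolev spaces on `ℝⁿ × (0, T)` -/

/-- The strip `ℝⁿ_T = {(x, t) : 0 < t < T}`, `0 < T ≤ ∞`. -/
def strip (n : ℕ) (T : ℝ≥0∞) : Set (Rn n × ℝ) :=
  {z | 0 < z.2 ∧ ENNReal.ofReal z.2 < T}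

/-- The classical derivative `D_X^β D_t^l η` of a (smooth) function on space-time. -/
def mixedDeriv {n : ℕ} (β : Fin n → ℕ) (l : ℕ) (η : Rn n × ℝ → ℝ) : Rn n × ℝ → ℝ :=
  (List.finRange n).foldr
    (fun k g => (fun h z => lineDeriv ℝ h z (EuclideanSpace.single k (1 : ℝ), (0 : ℝ)))^[β k] g)
    ((fun h z => lineDeriv ℝ h z ((0 : Rn n), (1 : ℝ)))^[l] η)

/-- `w` is the weak derivative `D_X^β D_t^l v` in the open set `Ω`. -/
def HasWeakDeriv {n : ℕ} (Ω : Set (Rn n × ℝ)) (β : Fin n → ℕ) (l : ℕ)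
    (v w : Rn n × ℝ → ℂ) : Prop :=
  LocallyIntegrableOn v Ω volume ∧ LocallyIntegrableOn w Ω volume ∧
    ∀ η : Rn n × ℝ → ℝ, ContDiff ℝ ∞ η → HasCompactSupport η → tsupport η ⊆ Ω →
      ∫ z in Ω, mixedDeriv β l η z • v z
        = (-1 : ℂ) ^ ((∑ k, β k) + l) * ∫ z in Ω, η z • w z

/-- The pairs `(β, l)` with `|β| + 2l ≤ 2i`. -/
def parabolicIndex (n i : ℕ) : Finset ((Fin n → ℕ) × ℕ) :=
  (Fintype.piFinset (fun _ : Fin n => Finset.range (2 * i + 1)) ×ˢ Finset.range (i + 1)).filter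
    (fun a => (∑ k, a.1 k) + 2 * a.2 ≤ 2 * i)

theorem mem_parabolicIndex {n i : ℕ} {a : (Fin n → ℕ) × ℕ} :
    a ∈ parabolicIndex n i ↔ (∑ k, a.1 k) + 2 * a.2 ≤ 2 * i := by
  simp only [parabolicIndex, Finset.mem_filter, Finset.mem_product, Fintype.mem_piFinset,
    Finset.mem_range, and_iff_right_iff_imp]
  intro h
  refine ⟨fun k => ?_, by omega⟩
  have := Finset.single_le_sum (f := a.1) (fun _ _ => Nat.zero_le _) (Finset.mem_univ k)
  omega

/-- The norm of `W^{2i,i}_p(ℝⁿ_T)`, with values in `[0, ∞]`. Weak derivatives are unique almost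
everywhere, so the infimum runs over equal values; it is `∞` if some weak derivative does not
exist. -/
def parabolicSobolevNorm {n : ℕ} (i : ℕ) (p T : ℝ≥0∞) (v : Rn n × ℝ → ℂ) : ℝ≥0∞ :=
  ⨅ (w : (Fin n → ℕ) × ℕ → Rn n × ℝ → ℂ)
    (_ : ∀ a ∈ parabolicIndex n i, HasWeakDeriv (strip n T) a.1 a.2 v (w a)),
    if p = ⊤ then
      ∑ a ∈ parabolicIndex n i, eLpNorm (w a) ⊤ (volume.restrict (strip n T))
    else
      (∑ a ∈ parabolicIndex n i,
        eLpNorm (w a) p (volume.restrict (strip n T)) ^ p.toReal) ^ (1 / p.toReal)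

end

/-! On the Fourier side the caloric extension is `u(·,t)^ = exp(-tλ) f^` with `λ(ξ) = 4π²|ξ|²`. Fix
a smooth bump `η ≥ 0` supported at positive times below `T`, with Laplace transform `L(r) = ∫ η(t)
exp(-tr) dt > 0`. Integration by parts gives `λ^i L(λ) = ∫ η^(i)(t) exp(-tλ) dt`. So if `φ^ = k^ λ^i
L(λ)`, then `φ * f = ∫ η^(i)(t) (k * u(·,t)) dt = (-1)^i ∫ η(t) (k * ∂_t^i u(·,t)) dt`: a frequency
piece of `f` is an average of the weak derivative `∂_t^i u` (`convDist_eq_integral_weakDeriv`).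

Such a `k` exists because `φ^` is supported in an annulus, where `λ` does not vanish. For `ψ^`,
whose support contains the origin, the same is done with `i = 0`, where only `L(λ)` has to be
divided out.

Parabolic scaling turns this into a formula for `φ_j * f`: the times are of order `4^(-j)` and the
kernel has `L¹` norm `4^(-ij) ‖k‖₁` (`fourier_dilate_eq`). Hölder and Tonelli then bound `‖φ_j *
f‖_p^p` by `4^(-ijp) ‖k‖₁^p 4^j` times the integral of `|∂_t^i u|^p` over a slab of such times
(`lintegral_dyadic_rpow_le`). The Besov weight `2^((2i-2/p)jp)` cancels the powers of `4` exactly,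
and the slabs are disjoint for different `j`, so summation yields at most `‖k‖₁^p ‖∂_t^i u‖_p^p`
(`tsum_dyadicPiece_le`).

The constant is independent of `i` because `λ ≥ 2` on the support of `φ^`: the factors `λ^(-i)` then
have derivatives bounded uniformly in `i`, hence so are the norms `‖k‖₁`
(`exists_fourier_eq_mul_laplaceSymbol_pow`). As `f` is only a distribution, pairing with `f` has to
be exchanged with the space-time integral; this is `TemperedDistribution.integral_apply`. -/

/-! ### Integrals of families of Schwartz functions paired with a tempered distribution -/

section WeakIntegral

open Filter Topology Set

variable {E : Type*} [NormedAddCommGroup E] [NormedSpace ℝ E]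

/-- The space of values of the `l`-th derivative of a complex function on `E`. -/
def DerivValue (E : Type*) [NormedAddCommGroup E] [NormedSpace ℝ E] (l : ℕ) : Type _ :=
  ContinuousMultilinearMap ℝ (fun _ : Fin l => E) ℂ

noncomputable instance (l : ℕ) : NormedAddCommGroup (DerivValue E l) :=
  inferInstanceAs (NormedAddCommGroup (ContinuousMultilinearMap ℝ (fun _ : Fin l => E) ℂ))

noncomputable instance (l : ℕ) : NormedSpace ℂ (DerivValue E l) :=
  inferInstanceAs (NormedSpace ℂ (ContinuousMultilinearMap ℝ (fun _ : Fin l => E) ℂ))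

instance (l : ℕ) : CompleteSpace (DerivValue E l) :=
  inferInstanceAs (CompleteSpace (ContinuousMultilinearMap ℝ (fun _ : Fin l => E) ℂ))

/-- The `l`-th derivative of `g` at `x`, as an element of `DerivValue E l`. -/
noncomputable def derivValue (l : ℕ) (g : E → ℂ) (x : E) : DerivValue E l := iteratedFDeriv ℝ l g x

theorem norm_derivValue (l : ℕ) (g : E → ℂ) (x : E) :
    ‖derivValue l g x‖ = ‖iteratedFDeriv ℝ l g x‖ := rfl

/-- An element of `DerivValue E l` as a multilinear map. -/
def DerivValue.toMultilinear {l : ℕ} (A : DerivValue E l) :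
    ContinuousMultilinearMap ℝ (fun _ : Fin l => E) ℂ := A

/-- Evaluation of an element of `DerivValue E l` at a tuple of vectors. -/
noncomputable def DerivValue.evalCLM {l : ℕ} (v : Fin l → E) : DerivValue E l →L[ℂ] ℂ :=
  LinearMap.mkContinuous
    { toFun := fun A => A.toMultilinear v
      map_add' := fun _ _ => rfl
      map_smul' := fun _ _ => rfl }
    (∏ i, ‖v i‖) fun A => by
      rw [mul_comm]
      exact A.toMultilinear.le_opNorm v

theorem DerivValue.evalCLM_derivValue {l : ℕ} (v : Fin l → E) (g : E → ℂ) (x : E) :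
    DerivValue.evalCLM v (derivValue l g x) = iteratedFDeriv ℝ l g x v := rfl

theorem DerivValue.ext_evalCLM {l : ℕ} {A B : DerivValue E l}
    (h : ∀ v, DerivValue.evalCLM v A = DerivValue.evalCLM v B) : A = B :=
  ContinuousMultilinearMap.ext (f := A.toMultilinear) (f' := B.toMultilinear) h

/-- The weighted derivative `x ↦ ‖x‖ ^ k • D ^ l g x` of a Schwartz function as a bounded continuous
function. -/
noncomputable def SchwartzMap.weightedDeriv (k l : ℕ) :
    𝓢(E, ℂ) →ₗ[ℂ] BoundedContinuousFunction E (DerivValue E l) where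
  toFun g := BoundedContinuousFunction.ofNormedAddCommGroup
    (fun x => ((‖x‖ ^ k : ℝ) : ℂ) • derivValue l g x)
    ((Complex.continuous_ofReal.comp (continuous_norm.pow k)).smul
      (show Continuous (derivValue l g) from
        (g.smooth ⊤).continuous_iteratedFDeriv (by exact_mod_cast le_top)))
    (SchwartzMap.seminorm ℂ k l g) fun x => by
      rw [norm_smul, Complex.norm_real, norm_pow, norm_norm]
      exact g.le_seminorm ℂ k l x
  map_add' g h := by
    ext x : 1
    simp only [BoundedContinuousFunction.coe_ofNormedAddCommGroup,
      BoundedContinuousFunction.coe_add, Pi.add_apply]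
    rw [← smul_add]
    congr 1
    exact iteratedFDeriv_add_apply (g.smooth l).contDiffAt (h.smooth l).contDiffAt
  map_smul' c g := by
    ext x : 1
    simp only [BoundedContinuousFunction.coe_ofNormedAddCommGroup,
      BoundedContinuousFunction.coe_smul, RingHom.id_apply]
    rw [smul_comm]
    congr 1
    exact iteratedFDeriv_const_smul_apply (g.smooth l).contDiffAt

theorem SchwartzMap.weightedDeriv_apply (k l : ℕ) (g : 𝓢(E, ℂ)) (x : E) :
    weightedDeriv k l g x = ((‖x‖ ^ k : ℝ) : ℂ) • derivValue l g x := rfl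

/-- Realizes a Schwartz seminorm as the norm of a Banach space, so that Bochner integration becomes
available although the Schwartz space is not normed. -/
theorem SchwartzMap.norm_weightedDeriv (k l : ℕ) (g : 𝓢(E, ℂ)) :
    ‖weightedDeriv k l g‖ = SchwartzMap.seminorm ℂ k l g := by
  have h : ∀ x, ‖weightedDeriv k l g x‖ = ‖x‖ ^ k * ‖iteratedFDeriv ℝ l g x‖ := fun x => by
    rw [weightedDeriv_apply, norm_smul, Complex.norm_real, norm_pow, norm_norm, norm_derivValue]
  refine le_antisymm ?_ ?_
  · refine (BoundedContinuousFunction.norm_le (apply_nonneg _ _)).2 fun x => ?_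
    rw [h]
    exact g.le_seminorm ℂ k l x
  · refine seminorm_le_bound ℂ k l g (norm_nonneg (weightedDeriv k l g)) fun x => ?_
    rw [← h]
    exact (weightedDeriv k l g).norm_coe_le_norm x

theorem SchwartzMap.continuous_weightedDeriv (k l : ℕ) :
    Continuous (weightedDeriv (E := E) k l) :=
  (schwartz_withSeminorms ℂ E ℂ).continuous_of_isBounded
    (norm_withSeminorms ℂ _) _ fun _ => ⟨{(k, l)}, 1, fun g => by
      rw [Finset.sup_singleton, one_smul]
      exact (SchwartzMap.norm_weightedDeriv k l g).le⟩

theorem SchwartzMap.continuous_iteratedFDeriv_apply (l : ℕ) (x : E) :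
    Continuous fun g : 𝓢(E, ℂ) => iteratedFDeriv ℝ l g x := by
  have := ((BoundedContinuousFunction.evalCLM ℂ x).continuous.comp
    (continuous_weightedDeriv (E := E) 0 l))
  have h2 : Continuous fun g : 𝓢(E, ℂ) => derivValue l g x := this.congr fun g => by
    simp [weightedDeriv_apply]
  exact h2

/-- A tempered distribution is bounded by finitely many Schwartz seminorms. -/
theorem TemperedDistribution.exists_bound (f : 𝓢'(E, ℂ)) :
    ∃ (s : Finset (ℕ × ℕ)) (C : ℝ), 0 ≤ C ∧
      ∀ g, ‖f g‖ ≤ C * s.sup (schwartzSeminormFamily ℂ E ℂ) g := by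
  obtain ⟨s, C, -, h⟩ := Seminorm.bound_of_continuous (schwartz_withSeminorms ℂ E ℂ)
    ((normSeminorm ℂ ℂ).comp (f : 𝓢(E, ℂ) →ₗ[ℂ] ℂ)) (by
      change Continuous fun g => ‖f g‖
      exact (map_continuous f).norm)
  exact ⟨s, C, C.2, fun g => h g⟩

variable {Z : Type*} [MeasurableSpace Z] {μ : Measure Z}

theorem SchwartzMap.norm_iteratedFDeriv_apply_le (g : 𝓢(E, ℂ)) (l : ℕ) (x : E) (v : Fin l → E) :
    ‖iteratedFDeriv ℝ l g x v‖ ≤ SchwartzMap.seminorm ℂ 0 l g * ∏ i, ‖v i‖ :=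
  ((iteratedFDeriv ℝ l g x).le_opNorm v).trans <| by
    have := norm_iteratedFDeriv_le_seminorm ℂ g l x
    gcongr

theorem SchwartzMap.hasDerivAt_iteratedFDeriv_apply (g : 𝓢(E, ℂ)) (l : ℕ) (x w : E)
    (v : Fin l → E) (s : ℝ) :
    HasDerivAt (fun s : ℝ => iteratedFDeriv ℝ l g (x + s • w) v)
      (iteratedFDeriv ℝ (l + 1) g (x + s • w) (Fin.cons w v : Fin (l + 1) → E)) s := by
  have h1 : DifferentiableAt ℝ (iteratedFDeriv ℝ l g) (x + s • w) :=
    ((g.smooth ⊤).differentiable_iteratedFDeriv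
      (by exact_mod_cast ENat.natCast_lt_top l)).differentiableAt
  have h2 : HasDerivAt (fun s : ℝ => x + s • w) w s := by
    simpa using ((hasDerivAt_id s).smul_const w).const_add x
  have h3 := h1.hasFDerivAt.comp_hasDerivAt s h2
  have h4 := (ContinuousMultilinearMap.apply ℝ (fun _ : Fin l => E) ℂ
    v).hasFDerivAt.comp_hasDerivAt s h3
  refine h4.congr_deriv ?_
  rw [iteratedFDeriv_succ_apply_left]
  rfl

theorem SchwartzMap.integrable_iteratedFDeriv_apply {h : Z → 𝓢(E, ℂ)}
    (hm : AEStronglyMeasurable h μ)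
    (hb : ∀ k l, ∃ B : Z → ℝ, Integrable B μ ∧ ∀ᵐ z ∂μ, SchwartzMap.seminorm ℂ k l (h z) ≤ B z)
    (l : ℕ) (x : E) (v : Fin l → E) : Integrable (fun z => iteratedFDeriv ℝ l (h z) x v) μ := by
  obtain ⟨B, hB, hle⟩ := hb 0 l
  refine (hB.mul_const (∏ i, ‖v i‖)).mono' ?_ (hle.mono fun z hz =>
    (norm_iteratedFDeriv_apply_le (h z) l x v).trans (by gcongr))
  have hc : Continuous fun g : 𝓢(E, ℂ) => iteratedFDeriv ℝ l g x v :=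
    (ContinuousMultilinearMap.apply ℝ (fun _ : Fin l => E) ℂ v).continuous.comp
      (continuous_iteratedFDeriv_apply l x)
  exact hc.comp_aestronglyMeasurable hm

/-- Differentiation under the integral sign for a family of Schwartz functions. -/
theorem SchwartzMap.iteratedFDeriv_apply_eq_integral {h : Z → 𝓢(E, ℂ)}
    (hm : AEStronglyMeasurable h μ)
    (hb : ∀ k l, ∃ B : Z → ℝ, Integrable B μ ∧ ∀ᵐ z ∂μ, SchwartzMap.seminorm ℂ k l (h z) ≤ B z)
    {H : 𝓢(E, ℂ)} (hH : ∀ x, H x = ∫ z, h z x ∂μ) (l : ℕ) (x : E) (v : Fin l → E) :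
    iteratedFDeriv ℝ l H x v = ∫ z, iteratedFDeriv ℝ l (h z) x v ∂μ := by
  induction l generalizing x with
  | zero => simpa using hH x
  | succ l ih =>
    have hv : v = Fin.cons (v 0) (Fin.tail v) := (Fin.cons_self_tail v).symm
    obtain ⟨B, hB, hle⟩ := hb 0 (l + 1)
    have h1 := hasDerivAt_iteratedFDeriv_apply H l x (v 0) (Fin.tail v) 0
    have h2 := (hasDerivAt_integral_of_dominated_loc_of_deriv_le (μ := μ) (x₀ := (0 : ℝ))
      (s := univ) (bound := fun z => B z * ∏ i, ‖v i‖)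
      (F := fun (s : ℝ) z => iteratedFDeriv ℝ l (h z) (x + s • v 0) (Fin.tail v))
      (F' := fun (s : ℝ) z => iteratedFDeriv ℝ (l + 1) (h z) (x + s • v 0)
        (Fin.cons (v 0) (Fin.tail v) : Fin (l + 1) → E)) univ_mem
      (Eventually.of_forall fun s =>
        (integrable_iteratedFDeriv_apply hm hb l _ _).aestronglyMeasurable)
      (integrable_iteratedFDeriv_apply hm hb l _ _)
      (integrable_iteratedFDeriv_apply hm hb (l + 1) _ _).aestronglyMeasurable
      (hle.mono fun z hz s _ => by
        rw [← hv]
        exact (norm_iteratedFDeriv_apply_le (h z) (l + 1) _ v).trans (by gcongr))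
      (hB.mul_const _)
      -- The derivative is taken along the line through `x` in the direction `v 0`; the induction
      -- hypothesis is applied at every point of that line.
      (Eventually.of_forall fun z s _ =>
        hasDerivAt_iteratedFDeriv_apply (h z) l x (v 0) (Fin.tail v) s)).2
    have h3 := h1.unique (h2.congr_of_eventuallyEq
      (Eventually.of_forall fun s => ih (x + s • v 0) (Fin.tail v)))
    rw [← hv] at h3
    simpa using h3

/-- A tempered distribution commutes with the pointwise integral of a family of Schwartz functions
whose seminorms are dominated by integrable functions. -/
theorem TemperedDistribution.integral_apply (f : 𝓢'(E, ℂ)) {h : Z → 𝓢(E, ℂ)}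
    (hm : AEStronglyMeasurable h μ)
    (hb : ∀ k l, ∃ B : Z → ℝ, Integrable B μ ∧ ∀ᵐ z ∂μ, SchwartzMap.seminorm ℂ k l (h z) ≤ B z)
    {H : 𝓢(E, ℂ)} (hH : ∀ x, H x = ∫ z, h z x ∂μ) :
    ∫ z, f (h z) ∂μ = f H := by
  obtain ⟨s, C, hC, hf⟩ := f.exists_bound
  -- Only the finitely many seminorms in `s` control `f`. They embed the problem in a Banach space,
  -- and `f` extends to a bounded functional `Λ` on the closure `R` of the image, where a Bochner
  -- integral can be formed.
  let J : 𝓢(E, ℂ) →ₗ[ℂ] ((a : s) → BoundedContinuousFunction E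
      (DerivValue E a.1.2)) :=
    LinearMap.pi fun a => weightedDeriv a.1.1 a.1.2
  have hJc : Continuous J := continuous_pi fun a => continuous_weightedDeriv a.1.1 a.1.2
  let R := (LinearMap.range J).topologicalClosure
  let e : 𝓢(E, ℂ) →ₗ[ℂ] R := J.codRestrict R fun g =>
    (LinearMap.range J).le_topologicalClosure (LinearMap.mem_range_self J g)
  have he : Continuous e := hJc.subtype_mk _
  have hdense : DenseRange e := by
    intro y
    rw [closure_subtype]
    have : (Subtype.val '' range e : Set _) = LinearMap.range J := by
      ext w
      constructor
      · rintro ⟨_, ⟨g, rfl⟩, rfl⟩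
        exact ⟨g, rfl⟩
      · rintro ⟨g, rfl⟩
        exact ⟨e g, ⟨g, rfl⟩, rfl⟩
    rw [this]
    exact y.2
  have hnorm : ∀ g, ‖(f : 𝓢(E, ℂ) →ₗ[ℂ] ℂ) g‖ ≤ C * ‖e g‖ := by
    intro g
    refine (hf g).trans (mul_le_mul_of_nonneg_left ?_ hC)
    refine Seminorm.finset_sup_apply_le (norm_nonneg _) fun a ha => ?_
    rw [schwartzSeminormFamily, ← norm_weightedDeriv]
    exact norm_le_pi_norm (J g) ⟨a, ha⟩
  let Λ := (f : 𝓢(E, ℂ) →ₗ[ℂ] ℂ).extendOfNorm e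
  have hΛ : ∀ g, f g = Λ (e g) := fun g => (LinearMap.extendOfNorm_eq hdense ⟨C, hnorm⟩ g).symm
  have : CompleteSpace R := (Submodule.isClosed_topologicalClosure _).completeSpace_coe
  have hem : AEStronglyMeasurable (fun z => e (h z)) μ := he.comp_aestronglyMeasurable hm
  have hei : Integrable (fun z => e (h z)) μ := by
    choose B hB hle using hb
    have hBs : Integrable (fun z => ∑ a ∈ s, ‖B a.1 a.2 z‖) μ :=
      integrable_finsetSum _ fun a _ => (hB a.1 a.2).norm
    refine hBs.mono' hem ?_
    filter_upwards [(ae_all_iff.2 fun a : ℕ × ℕ => hle a.1 a.2)] with z hz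
    refine (pi_norm_le_iff_of_nonneg (Finset.sum_nonneg fun _ _ => norm_nonneg _)).2 fun a => ?_
    refine le_trans (le_of_eq (norm_weightedDeriv a.1.1 a.1.2 (h z))) ?_
    refine (hz a.1).trans ((le_abs_self _).trans ?_)
    exact Finset.single_le_sum (f := fun a : ℕ × ℕ => ‖B a.1 a.2 z‖)
      (fun _ _ => norm_nonneg _) a.2
  simp_rw [hΛ]
  rw [Λ.integral_comp_comm hei]
  congr 1
  -- The Bochner integral is identified with `e H` by point evaluations, which are continuous
  -- functionals on `R`; this reduces to differentiation under the integral sign.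
  refine Subtype.ext (funext fun a => BoundedContinuousFunction.ext fun x => ?_)
  refine DerivValue.ext_evalCLM fun v => ?_
  have h1 := ((((DerivValue.evalCLM v).comp (BoundedContinuousFunction.evalCLM ℂ x)).comp
    (ContinuousLinearMap.proj a)).comp R.subtypeL).integral_comp_comm hei
  refine Eq.trans h1.symm ?_
  change ∫ z, DerivValue.evalCLM v (weightedDeriv a.1.1 a.1.2 (h z) x) ∂μ
    = DerivValue.evalCLM v (weightedDeriv a.1.1 a.1.2 H x)
  simp only [weightedDeriv_apply, map_smul, DerivValue.evalCLM_derivValue]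
  rw [integral_smul, iteratedFDeriv_apply_eq_integral hm hb hH]

/-- Continuity of a family of Schwartz functions from joint continuity of the derivatives and local
boundedness of the seminorms. -/
theorem SchwartzMap.continuous_of_continuous_iteratedFDeriv [ProperSpace E] {Z : Type*}
    [TopologicalSpace Z] {h : Z → 𝓢(E, ℂ)}
    (hc : ∀ l, Continuous fun q : Z × E => iteratedFDeriv ℝ l (h q.1) q.2)
    (hb : ∀ z₀ k l, ∃ C, ∀ᶠ z in 𝓝 z₀, SchwartzMap.seminorm ℂ k l (h z) ≤ C) :
    Continuous h := by
  rw [continuous_iff_continuousAt]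
  intro z₀
  rw [ContinuousAt, (schwartz_withSeminorms ℂ E ℂ).tendsto_nhds]
  rintro ⟨k, l⟩ ε hε
  obtain ⟨C, hC⟩ := hb z₀ (k + 1) l
  have hC0 : 0 ≤ C := (apply_nonneg _ _).trans hC.self_of_nhds
  -- Outside the ball of radius `R` the extra power of `‖x‖` in the `(k + 1, l)` seminorm makes the
  -- difference at most `2C / R ≤ ε / 2`; inside, compactness gives uniform convergence.
  set R : ℝ := 4 * C / ε + 1 with hR
  have hR0 : 0 < R := by positivity
  have hK : IsCompact (Metric.closedBall (0 : E) R) := isCompact_closedBall 0 R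
  have hloc : ∀ᶠ z in 𝓝 z₀, ∀ x ∈ Metric.closedBall (0 : E) R,
      ‖x‖ ^ k * ‖iteratedFDeriv ℝ l (h z) x - iteratedFDeriv ℝ l (h z₀) x‖ < ε / 2 := by
    refine hK.eventually_forall_of_forall_eventually fun x _ => ?_
    have hcont : Continuous fun q : Z × E => ‖q.2‖ ^ k *
        ‖iteratedFDeriv ℝ l (h q.1) q.2 - iteratedFDeriv ℝ l (h z₀) q.2‖ := by
      refine (continuous_snd.norm.pow k).mul ((hc l).sub ?_).norm
      exact (hc l).comp (continuous_const.prodMk continuous_snd)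
    exact hcont.continuousAt.eventually_lt_const (by simpa using by positivity)
  filter_upwards [hC, hloc] with z hz hzl
  refine lt_of_le_of_lt (b := ε / 2) ?_ (by linarith)
  refine seminorm_le_bound ℂ k l _ (by positivity) fun x => ?_
  have hsub : iteratedFDeriv ℝ l (⇑(h z - h z₀)) x
      = iteratedFDeriv ℝ l (h z) x - iteratedFDeriv ℝ l (h z₀) x :=
    iteratedFDeriv_sub_apply ((h z).smooth l).contDiffAt ((h z₀).smooth l).contDiffAt
  rw [hsub]
  by_cases hx : ‖x‖ ≤ R
  · exact (hzl x (by simpa using hx)).le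
  · push Not at hx
    have h1 := (le_seminorm ℂ (k + 1) l (h z) x).trans hz
    have h2 := (le_seminorm ℂ (k + 1) l (h z₀) x).trans hC.self_of_nhds
    have h3 := norm_sub_le (iteratedFDeriv ℝ l (h z) x) (iteratedFDeriv ℝ l (h z₀) x)
    have h4 : ‖x‖ * (‖x‖ ^ k * ‖iteratedFDeriv ℝ l (h z) x - iteratedFDeriv ℝ l (h z₀) x‖)
        ≤ 2 * C := by
      calc _ ≤ ‖x‖ * (‖x‖ ^ k * (‖iteratedFDeriv ℝ l (h z) x‖ + ‖iteratedFDeriv ℝ l (h z₀) x‖)) := by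
            gcongr
        _ = ‖x‖ ^ (k + 1) * ‖iteratedFDeriv ℝ l (h z) x‖
            + ‖x‖ ^ (k + 1) * ‖iteratedFDeriv ℝ l (h z₀) x‖ := by ring
        _ ≤ _ := by linarith
    have h5 : 2 * C ≤ ‖x‖ * (ε / 2) := by
      calc 2 * C = 4 * C / ε * (ε / 2) := by field_simp; ring
        _ ≤ ‖x‖ * (ε / 2) := by gcongr; linarith
    exact le_of_mul_le_mul_left (h4.trans h5) (hR0.trans hx)

end WeakIntegral

/-! ### The heat kernel as a continuous family of Schwartz functions -/

section HeatKernelFamily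

open Filter Topology Set

/-- The Gaussian `exp (-‖x‖²)` as a complex Schwartz function. -/
noncomputable def unitGaussian (n : ℕ) : 𝓢(Rn n, ℂ) :=
  (gaussianSchwartz n 1 one_pos).postcompCLM Complex.ofRealCLM

theorem unitGaussian_apply {n : ℕ} (x : Rn n) :
    unitGaussian n x = ((Real.exp (-‖x‖ ^ 2) : ℝ) : ℂ) := by
  change ((Real.exp (-1 * ‖x‖ ^ 2) : ℝ) : ℂ) = _
  rw [neg_one_mul]

/-- The normalizing factor of the heat kernel. -/
noncomputable def heatFactor (n : ℕ) (t : ℝ) : ℝ := (4 * Real.pi * t) ^ (-(n : ℝ) / 2)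

/-- The inverse length scale of the heat kernel. -/
noncomputable def heatScale (t : ℝ) : ℝ := (Real.sqrt (4 * t))⁻¹

theorem heatFactor_pos (n : ℕ) {t : ℝ} (ht : 0 < t) : 0 < heatFactor n t := by
  unfold heatFactor; positivity

theorem heatScale_pos {t : ℝ} (ht : 0 < t) : 0 < heatScale t := by
  unfold heatScale; positivity

theorem continuousOn_heatFactor (n : ℕ) : ContinuousOn (heatFactor n) (Ioi 0) := by
  intro t (ht : 0 < t)
  refine ContinuousAt.continuousWithinAt ?_
  unfold heatFactor
  exact ContinuousAt.rpow_const (by fun_prop) (Or.inl (by positivity))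

theorem continuousOn_heatScale : ContinuousOn heatScale (Ioi 0) := by
  intro t (ht : 0 < t)
  refine ContinuousAt.continuousWithinAt ?_
  unfold heatScale
  exact ContinuousAt.inv₀ (by fun_prop) (by positivity)

/-- All heat kernels are affine rescalings of one Gaussian, so estimates on their derivatives reduce
to the Schwartz seminorms of `unitGaussian`. -/
theorem reflectAt_heatKernel_eq {n : ℕ} {t : ℝ} (ht : 0 < t) (y : Rn n) :
    (reflectAt (heatKernel n t) y : Rn n → ℂ)
      = (heatFactor n t : ℂ) • fun x => unitGaussian n (heatScale t • y + (-heatScale t) • x) := by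
  funext x
  rw [reflectAt_apply, heatKernel_apply n ht]
  have h1 : heatScale t • y + (-heatScale t) • x = heatScale t • (y - x) := by
    rw [neg_smul, smul_sub, sub_eq_add_neg]
  have h2 : heatScale t ^ 2 = (4 * t)⁻¹ := by
    rw [heatScale, inv_pow, Real.sq_sqrt (by positivity)]
  simp only [Pi.smul_apply, h1, unitGaussian_apply, smul_eq_mul]
  rw [norm_smul, mul_pow, Real.norm_eq_abs, sq_abs, h2, Complex.ofReal_mul, heatFactor]
  congr 4
  ring

theorem iteratedFDeriv_reflectAt_heatKernel {n : ℕ} {t : ℝ} (ht : 0 < t) (l : ℕ) (y x : Rn n) :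
    iteratedFDeriv ℝ l (reflectAt (heatKernel n t) y) x
      = (heatFactor n t : ℂ) • (-heatScale t) ^ l •
        iteratedFDeriv ℝ l (unitGaussian n) (heatScale t • y + (-heatScale t) • x) := by
  have h0 : ContDiff ℝ l (fun w : Rn n => unitGaussian n (heatScale t • y + w)) :=
    ((unitGaussian n).smooth l).comp (contDiff_const.add contDiff_id)
  rw [reflectAt_heatKernel_eq ht]
  have h2 : ContDiff ℝ l
      (fun x : Rn n => unitGaussian n (heatScale t • y + (-heatScale t) • x)) :=
    h0.comp (contDiff_const_smul (-heatScale t))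
  rw [iteratedFDeriv_const_smul_apply h2.contDiffAt]
  congr 1
  have h1 := congrFun (iteratedFDeriv_comp_const_smul (𝕜 := ℝ) (-heatScale t) h0) x
  refine h1.trans ?_
  congr 1
  exact congrFun (iteratedFDeriv_comp_add_left' l (heatScale t • y)) _

/-- The bound is kept explicit: its dependence on `t` is continuous, hence bounded on compact time
intervals, and its growth in `y` is polynomial, hence absorbed by a Schwartz function of `y`. -/
theorem seminorm_reflectAt_heatKernel_le (n k l : ℕ) : ∃ M : ℝ, 0 ≤ M ∧ ∀ (y : Rn n) (t : ℝ), 0 < t →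
    SchwartzMap.seminorm ℂ k l (reflectAt (heatKernel n t) y)
      ≤ heatFactor n t * heatScale t ^ l * (1 + (heatScale t)⁻¹) ^ k * M * (1 + ‖y‖) ^ k := by
  obtain ⟨M, hM0, hM⟩ : ∃ M : ℝ, 0 ≤ M ∧ ∀ X : Rn n,
      (1 + ‖X‖) ^ k * ‖iteratedFDeriv ℝ l (unitGaussian n) X‖ ≤ M :=
    ⟨_, by positivity, fun X => one_add_le_sup_seminorm_apply (𝕜 := ℂ) (m := (k, l)) le_rfl le_rfl
      (unitGaussian n) X⟩
  refine ⟨M, hM0, fun y t ht => ?_⟩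
  have hc := heatFactor_pos n ht
  have ha := heatScale_pos ht
  refine seminorm_le_bound ℂ k l _ (by positivity) fun x => ?_
  rw [iteratedFDeriv_reflectAt_heatKernel ht, norm_smul, norm_smul, Complex.norm_real, norm_pow,
    norm_neg, Real.norm_of_nonneg hc.le, Real.norm_of_nonneg ha.le]
  set X := heatScale t • y + (-heatScale t) • x with hX
  -- Solving the affine substitution for `x` trades the weight in `x` for weights in `y` and in the
  -- Gaussian variable `X`.
  have hx : ‖x‖ ≤ (1 + (heatScale t)⁻¹) * (1 + ‖y‖) * (1 + ‖X‖) := by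
    have h1 : x = y - (heatScale t)⁻¹ • X := by
      rw [hX, smul_add, smul_smul, smul_smul, mul_neg, inv_mul_cancel₀ ha.ne']
      simp
    have h2 : ‖x‖ ≤ ‖y‖ + (heatScale t)⁻¹ * ‖X‖ := by
      calc ‖x‖ = ‖y - (heatScale t)⁻¹ • X‖ := by rw [← h1]
        _ ≤ _ := (norm_sub_le _ _).trans (by
          rw [norm_smul, norm_inv, Real.norm_of_nonneg ha.le])
    have h3 : 0 ≤ (heatScale t)⁻¹ := by positivity
    have h4 := norm_nonneg y
    have h5 := norm_nonneg X
    calc ‖x‖ ≤ _ := h2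
      _ ≤ _ := by
        have e : (1 + (heatScale t)⁻¹) * (1 + ‖y‖) * (1 + ‖X‖) = ‖y‖ + (heatScale t)⁻¹ * ‖X‖ +
          (1 + ‖X‖ + ‖y‖ * ‖X‖ + (heatScale t)⁻¹ * (1 + ‖y‖ + ‖y‖ * ‖X‖)) := by ring
        rw [e]
        have : 0 ≤ (1 + ‖X‖ + ‖y‖ * ‖X‖ + (heatScale t)⁻¹ * (1 + ‖y‖ + ‖y‖ * ‖X‖)) := by positivity
        linarith
  calc ‖x‖ ^ k * (heatFactor n t * (heatScale t ^ l * ‖iteratedFDeriv ℝ l (unitGaussian n) X‖))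
      ≤ ((1 + (heatScale t)⁻¹) * (1 + ‖y‖) * (1 + ‖X‖)) ^ k *
        (heatFactor n t * (heatScale t ^ l * ‖iteratedFDeriv ℝ l (unitGaussian n) X‖)) := by
        gcongr
    _ = heatFactor n t * heatScale t ^ l * (1 + (heatScale t)⁻¹) ^ k * (1 + ‖y‖) ^ k *
        ((1 + ‖X‖) ^ k * ‖iteratedFDeriv ℝ l (unitGaussian n) X‖) := by
        rw [mul_pow, mul_pow]; ring
    _ ≤ heatFactor n t * heatScale t ^ l * (1 + (heatScale t)⁻¹) ^ k * (1 + ‖y‖) ^ k * M := by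
        gcongr
        exact hM X
    _ = _ := by ring

theorem continuousOn_heatFactor_mul (n k l : ℕ) (M : ℝ) : ContinuousOn
    (fun t => heatFactor n t * heatScale t ^ l * (1 + (heatScale t)⁻¹) ^ k * M) (Ioi 0) :=
  (((continuousOn_heatFactor n).mul (continuousOn_heatScale.pow l)).mul
    ((continuousOn_const.add (continuousOn_heatScale.inv₀ fun _ ht => (heatScale_pos ht).ne')).pow
      k)).mul continuousOn_const

theorem exists_seminorm_reflectAt_heatKernel_le (n k l : ℕ) {a b : ℝ} (ha : 0 < a) :
    ∃ C : ℝ, 0 ≤ C ∧ ∀ y : Rn n, ∀ t ∈ Icc a b,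
      SchwartzMap.seminorm ℂ k l (reflectAt (heatKernel n t) y) ≤ C * (1 + ‖y‖) ^ k := by
  obtain ⟨M, -, hM⟩ := seminorm_reflectAt_heatKernel_le n k l
  obtain ⟨C, hC⟩ := (isCompact_Icc (a := a) (b := b)).exists_bound_of_continuousOn
    ((continuousOn_heatFactor_mul n k l M).mono fun t ht => lt_of_lt_of_le ha ht.1)
  refine ⟨max C 0, le_max_right _ _, fun y t ht => ?_⟩
  refine (hM y t (lt_of_lt_of_le ha ht.1)).trans ?_
  gcongr
  exact (le_abs_self _).trans ((hC t ht).trans (le_max_left _ _))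

theorem continuousOn_reflectAt_heatKernel (n : ℕ) :
    ContinuousOn (fun z : Rn n × ℝ => reflectAt (heatKernel n z.2) z.1) {z | 0 < z.2} := by
  rw [continuousOn_iff_continuous_domRestrict]
  have hpos : ∀ z : {z : Rn n × ℝ | 0 < z.2}, 0 < z.1.2 := fun z => z.2
  have ht : Continuous fun z : {z : Rn n × ℝ | 0 < z.2} => z.1.2 :=
    continuous_snd.comp continuous_subtype_val
  have hfac : Continuous fun z : {z : Rn n × ℝ | 0 < z.2} => heatFactor n z.1.2 :=
    (continuousOn_heatFactor n).comp_continuous ht hpos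
  have hsc : Continuous fun z : {z : Rn n × ℝ | 0 < z.2} => heatScale z.1.2 :=
    continuousOn_heatScale.comp_continuous ht hpos
  refine continuous_of_continuous_iteratedFDeriv (fun l => ?_) fun z₀ k l => ?_
  · have h1 : Continuous (iteratedFDeriv ℝ l (unitGaussian n)) :=
      ((unitGaussian n).smooth ⊤).continuous_iteratedFDeriv (by exact_mod_cast le_top)
    have h2 : Continuous fun q : {z : Rn n × ℝ | 0 < z.2} × Rn n =>
        (heatFactor n q.1.1.2 : ℂ) • (-heatScale q.1.1.2) ^ l • iteratedFDeriv ℝ l (unitGaussian n)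
          (heatScale q.1.1.2 • q.1.1.1 + (-heatScale q.1.1.2) • q.2) := by
      have hfac' := hfac.comp (continuous_fst (X := {z : Rn n × ℝ | 0 < z.2}) (Y := Rn n))
      have hsc' := hsc.comp (continuous_fst (X := {z : Rn n × ℝ | 0 < z.2}) (Y := Rn n))
      refine (Complex.continuous_ofReal.comp hfac').smul ((hsc'.neg.pow l).smul (h1.comp ?_))
      refine (hsc'.smul ?_).add (hsc'.neg.smul continuous_snd)
      exact continuous_fst.comp (continuous_subtype_val.comp continuous_fst)
    exact h2.congr fun q => (iteratedFDeriv_reflectAt_heatKernel (hpos q.1) l q.1.1.1 q.2).symm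
  · obtain ⟨M, -, hM⟩ := seminorm_reflectAt_heatKernel_le n k l
    have hcont : Continuous fun z : {z : Rn n × ℝ | 0 < z.2} =>
        heatFactor n z.1.2 * heatScale z.1.2 ^ l * (1 + (heatScale z.1.2)⁻¹) ^ k * M
          * (1 + ‖z.1.1‖) ^ k :=
      ((continuousOn_heatFactor_mul n k l M).comp_continuous ht hpos).mul
        ((continuous_const.add (continuous_fst.comp continuous_subtype_val).norm).pow k)
    obtain ⟨C, hC⟩ := exists_gt (heatFactor n z₀.1.2 * heatScale z₀.1.2 ^ l *
      (1 + (heatScale z₀.1.2)⁻¹) ^ k * M * (1 + ‖z₀.1.1‖) ^ k)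
    refine ⟨C, ?_⟩
    filter_upwards [hcont.continuousAt.eventually_lt_const hC] with z hz
    exact (hM z.1.1 z.1.2 (hpos z)).trans hz.le

theorem continuousOn_caloricExtension {n : ℕ} (f : 𝓢'(Rn n, ℂ)) :
    ContinuousOn (caloricExtension f) {z | 0 < z.2} :=
  (map_continuous f).comp_continuousOn (continuousOn_reflectAt_heatKernel n)

theorem exists_norm_caloricExtension_le {n : ℕ} (f : 𝓢'(Rn n, ℂ)) {a b : ℝ} (ha : 0 < a) :
    ∃ (C : ℝ) (N : ℕ), 0 ≤ C ∧ ∀ z : Rn n × ℝ, z.2 ∈ Icc a b →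
      ‖caloricExtension f z‖ ≤ C * (1 + ‖z.1‖) ^ N := by
  obtain ⟨s, C, hC, hf⟩ := f.exists_bound
  choose D hD0 hD using fun k l => exists_seminorm_reflectAt_heatKernel_le n k l (b := b) ha
  refine ⟨C * ∑ c ∈ s, D c.1 c.2, s.sup Prod.fst,
    mul_nonneg hC (Finset.sum_nonneg fun _ _ => hD0 _ _), fun z hz => (hf _).trans ?_⟩
  rw [mul_assoc]
  gcongr
  have hs0 : 0 ≤ ∑ c ∈ s, D c.1 c.2 := Finset.sum_nonneg fun _ _ => hD0 _ _
  refine Seminorm.finset_sup_apply_le (by positivity) fun c hc => ?_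
  refine (hD c.1 c.2 z.1 z.2 hz).trans ?_
  gcongr
  · exact Finset.single_le_sum (f := fun c : ℕ × ℕ => D c.1 c.2) (fun _ _ => hD0 _ _) hc
  · linarith [norm_nonneg z.1]
  · exact Finset.le_sup (f := Prod.fst) hc

end HeatKernelFamily

/-! ### Frequency pieces of a distribution as averages of its caloric extension -/

section Representation

open Filter Topology Set

/-- The symbol `4 π² ‖ξ‖²` of the negative Laplacian. -/
noncomputable def laplaceSymbol {n : ℕ} (ξ : Rn n) : ℝ := 4 * Real.pi ^ 2 * ‖ξ‖ ^ 2

theorem continuous_laplaceSymbol {n : ℕ} : Continuous (laplaceSymbol (n := n)) := by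
  unfold laplaceSymbol; fun_prop

theorem laplaceSymbol_nonneg {n : ℕ} (ξ : Rn n) : 0 ≤ laplaceSymbol ξ := by
  unfold laplaceSymbol; positivity

/-- The Laplace transform `∫ η(t) e^{-rt} dt`. -/
noncomputable def laplaceWeight (η : ℝ → ℝ) (r : ℝ) : ℝ := ∫ t, η t * Real.exp (-t * r)

/-- The Fourier transform of a translate of the heat kernel, in Parseval form. -/
theorem integral_mul_heatKernel {n : ℕ} (g : 𝓢(Rn n, ℂ)) {t : ℝ} (ht : 0 < t) (x x' : Rn n) :
    ∫ y, reflectAt g x y * heatKernel n t (y - x')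
      = ∫ ξ, 𝓕 g ξ * Complex.exp (-(t * laplaceSymbol ξ : ℝ) +
          2 * Real.pi * Complex.I * (inner ℝ (x - x') ξ : ℝ)) := by
  set v := x - x' with hv
  set b : ℂ := ((4 * Real.pi ^ 2 * t : ℝ) : ℂ) with hb
  have hbr : 0 < b.re := by rw [hb, Complex.ofReal_re]; positivity
  set h : Rn n → ℂ := fun ξ => Complex.exp (-b * ‖ξ‖ ^ 2 +
    2 * Real.pi * Complex.I * (inner ℝ v ξ : ℝ)) with hh
  have hint : Integrable h := GaussianFourier.integrable_cexp_neg_mul_sq_norm_add hbr _ v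
  have hF : ∀ w, 𝓕 h w = heatKernel n t (v - w) := by
    intro w
    rw [hh, fourier_gaussian_innerProductSpace' hbr, heatKernel_apply n ht, Complex.ofReal_mul,
      Complex.ofReal_exp, Complex.ofReal_cpow (by positivity)]
    have hpi : (Real.pi : ℂ) ≠ 0 := by exact_mod_cast Real.pi_ne_zero
    have htc : (t : ℂ) ≠ 0 := by exact_mod_cast ht.ne'
    congr 1
    · have h1 : (Real.pi : ℂ) / b = ((4 * Real.pi * t : ℝ) : ℂ)⁻¹ := by
        rw [hb]; push_cast; field_simp
      rw [h1, ← Complex.ofReal_inv, show ((Module.finrank ℝ (Rn n) : ℂ) / 2) = ((n / 2 : ℝ) : ℂ) by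
        simp, ← Complex.ofReal_cpow (by positivity), ← Complex.ofReal_cpow (by positivity),
        Real.inv_rpow (by positivity), ← Real.rpow_neg (by positivity), neg_div]
    · congr 1
      rw [hb]; push_cast; field_simp
  -- Self-adjointness of the Fourier transform; `h` is the modulated Gaussian whose transform is the
  -- translated heat kernel.
  have h1 : ∫ ξ, 𝓕 g ξ * h ξ = ∫ w, g w * 𝓕 h w := by
    simpa using! VectorFourier.integral_fourierIntegral_smul_eq_flip (L := innerₗ (Rn n))
      Real.continuous_fourierChar continuous_inner (g.integrable (μ := volume)) hint
  have h2 : ∀ ξ, h ξ = Complex.exp (-(t * laplaceSymbol ξ : ℝ) +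
      2 * Real.pi * Complex.I * (inner ℝ v ξ : ℝ)) := fun ξ => by
    rw [hh, hb, laplaceSymbol]
    push_cast
    ring_nf
  simp_rw [← h2]
  rw [h1, ← integral_sub_left_eq_self _ volume x]
  refine integral_congr_ae (Eventually.of_forall fun y => ?_)
  simp only [hF, reflectAt_apply]
  rw [sub_sub_cancel, hv]
  congr 2
  abel

theorem laplaceWeight_deriv {η : ℝ → ℝ} (hη : ContDiff ℝ ∞ η) (hc : HasCompactSupport η) (r : ℝ) :
    laplaceWeight (deriv η) r = r * laplaceWeight η r := by
  have he : ∀ t : ℝ, HasDerivAt (fun t : ℝ => Real.exp (-t * r)) (-r * Real.exp (-t * r)) t := by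
    intro t
    have := ((hasDerivAt_id t).neg.mul_const r).exp
    simpa [mul_comm] using this
  have hd : ∀ t, HasDerivAt η (deriv η t) t := fun t =>
    (hη.differentiable (by simp)).differentiableAt.hasDerivAt
  have hcd : Continuous (deriv η) := hη.continuous_deriv (by exact_mod_cast le_top)
  have hec : Continuous fun t : ℝ => Real.exp (-t * r) := by fun_prop
  have key := integral_mul_deriv_eq_deriv_mul_of_integrable (u := η) (u' := deriv η)
    (v := fun t : ℝ => Real.exp (-t * r)) (v' := fun t => -r * Real.exp (-t * r))
    (fun t _ => hd t) (fun t _ => he t)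
    ((hη.continuous.mul (continuous_const.mul hec)).integrable_of_hasCompactSupport hc.mul_right)
    ((hcd.mul hec).integrable_of_hasCompactSupport hc.deriv.mul_right)
    ((hη.continuous.mul hec).integrable_of_hasCompactSupport hc.mul_right)
  rw [laplaceWeight, laplaceWeight, ← integral_const_mul, ← neg_neg (∫ t, deriv η t * _), ← key,
    ← integral_neg]
  congr 1
  funext t
  ring

/-- This is the source of the factor `laplaceSymbol ξ ^ i`: each time derivative on the bump
contributes one power of the symbol, without boundary terms. -/
theorem integral_iteratedDeriv_mul_exp {η : ℝ → ℝ} (hη : ContDiff ℝ ∞ η)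
    (hc : HasCompactSupport η) (i : ℕ) (r : ℝ) :
    ∫ t, iteratedDeriv i η t * Real.exp (-t * r) = r ^ i * laplaceWeight η r := by
  induction i generalizing η with
  | zero => simp [laplaceWeight]
  | succ i ih =>
    rw [iteratedDeriv_succ', ih (by
      have := (contDiff_infty_iff_deriv.1 hη).2; exact this) hc.deriv, laplaceWeight_deriv hη hc]
    ring

theorem tsupport_iteratedDeriv_subset_tsupport (η : ℝ → ℝ) (i : ℕ) :
    tsupport (iteratedDeriv i η) ⊆ tsupport η := by
  induction i generalizing η with
  | zero => simp
  | succ i ih => rw [iteratedDeriv_succ']; exact (ih _).trans (fun x hx => tsupport_deriv_subset hx)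

theorem SchwartzMap.integrable_one_add_norm_pow_mul {n : ℕ} (g : 𝓢(Rn n, ℂ)) (k : ℕ) :
    Integrable fun x => (1 + ‖x‖) ^ k * ‖g x‖ := by
  have h : ∀ x, (1 + ‖x‖) ^ k * ‖g x‖
      = ∑ m ∈ Finset.range (k + 1), (k.choose m : ℝ) * (‖x‖ ^ m * ‖g x‖) := by
    intro x
    rw [add_comm, add_pow, Finset.sum_mul]
    refine Finset.sum_congr rfl fun m _ => ?_
    rw [one_pow]; ring
  simp_rw [h]
  exact integrable_finsetSum _ fun m _ => (g.integrable_pow_mul volume m).const_mul _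

/-- Lebesgue measure on the slab `ℝⁿ × [a, b]`. -/
noncomputable def slabMeasure (n : ℕ) (a b : ℝ) : Measure (Rn n × ℝ) :=
  (volume : Measure (Rn n)).prod (volume.restrict (Icc a b))

theorem slabMeasure_eq_restrict (n : ℕ) (a b : ℝ) :
    slabMeasure n a b = volume.restrict (univ ×ˢ Icc a b) := by
  rw [slabMeasure, Measure.volume_eq_prod, ← Measure.prod_restrict, Measure.restrict_univ]

theorem ae_slabMeasure {n : ℕ} {a b : ℝ} : ∀ᵐ z ∂(slabMeasure n a b), z.2 ∈ Icc a b := by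
  rw [slabMeasure_eq_restrict]
  exact (ae_restrict_mem (MeasurableSet.univ.prod measurableSet_Icc)).mono fun z hz => hz.2

theorem aestronglyMeasurable_slabMeasure {n : ℕ} {a b : ℝ} (ha : 0 < a) {F : Type*}
    [TopologicalSpace F] [TopologicalSpace.PseudoMetrizableSpace F] {v : Rn n × ℝ → F}
    (hv : ContinuousOn v {z | 0 < z.2}) : AEStronglyMeasurable v (slabMeasure n a b) := by
  rw [slabMeasure_eq_restrict]
  exact (hv.mono fun z hz => lt_of_lt_of_le ha hz.2.1).aestronglyMeasurable
    (MeasurableSet.univ.prod measurableSet_Icc)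

theorem integrable_slabMeasure_mul {n : ℕ} {a b : ℝ} {G : Rn n → ℝ} {c : ℝ → ℝ}
    (hG : Integrable G) (hc : Continuous c) :
    Integrable (fun z : Rn n × ℝ => G z.1 * c z.2) (slabMeasure n a b) :=
  hG.mul_prod hc.integrableOn_Icc

/-- Pointwise form of the representation of `θ` by the heat kernel. -/
theorem integral_slabMeasure_heatKernel {n : ℕ} {g θ : 𝓢(Rn n, ℂ)} {η : ℝ → ℝ}
    (hη : ContDiff ℝ ∞ η) {a b : ℝ} (ha : 0 < a) (hsupp : tsupport η ⊆ Icc a b) (i : ℕ)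
    (hθ : ∀ ξ, 𝓕 θ ξ = 𝓕 g ξ *
      ((laplaceSymbol ξ ^ i * laplaceWeight η (laplaceSymbol ξ) : ℝ) : ℂ)) (x x' : Rn n) :
    ∫ z, (reflectAt g x z.1 * ((iteratedDeriv i η z.2 : ℝ) : ℂ)) * reflectAt (heatKernel n z.2) z.1 x'
      ∂(slabMeasure n a b) = θ (x - x') := by
  have hc : HasCompactSupport η := isCompact_Icc.of_isClosed_subset (isClosed_tsupport η) hsupp
  have hηi : Continuous (iteratedDeriv i η) := hη.continuous_iteratedDeriv i (by exact_mod_cast le_top)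
  have hηic : Continuous fun t => ((iteratedDeriv i η t : ℝ) : ℂ) := Complex.continuous_ofReal.comp hηi
  set v := x - x' with hv
  set G := reflectAt g x with hG
  obtain ⟨C, hC0, hC⟩ := exists_seminorm_reflectAt_heatKernel_le n 0 0 (b := b) ha
  have hint : Integrable (fun z : Rn n × ℝ => (G z.1 * ((iteratedDeriv i η z.2 : ℝ) : ℂ)) *
      reflectAt (heatKernel n z.2) z.1 x') (slabMeasure n a b) := by
    refine ((integrable_slabMeasure_mul (a := a) (b := b)
      (G.integrable (μ := volume)).norm hηi.norm).mul_const C).mono' ?_ ?_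
    · refine aestronglyMeasurable_slabMeasure ha (ContinuousOn.mul ?_ ?_)
      · exact ((G.continuous.comp continuous_fst).mul (hηic.comp continuous_snd)).continuousOn
      · have h := (BoundedContinuousFunction.evalCLM ℂ x').continuous.comp
          ((toBoundedContinuousFunctionCLM ℂ (Rn n) ℂ).continuous)
        exact h.comp_continuousOn (continuousOn_reflectAt_heatKernel n)
    · filter_upwards [ae_slabMeasure] with z hz
      rw [norm_mul, norm_mul, Complex.norm_real]
      gcongr
      have := hC z.1 z.2 hz
      rw [pow_zero, mul_one] at this
      exact (norm_le_seminorm ℂ _ x').trans this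
  rw [slabMeasure, integral_prod_symm _ hint]
  have hinner : ∀ t ∈ Icc a b, ∫ y, (G y * ((iteratedDeriv i η t : ℝ) : ℂ)) *
      reflectAt (heatKernel n t) y x' = ∫ ξ, ((iteratedDeriv i η t : ℝ) : ℂ) * (𝓕 g ξ *
        Complex.exp (-(t * laplaceSymbol ξ : ℝ) + 2 * Real.pi * Complex.I * (inner ℝ v ξ : ℝ))) := by
    intro t ht
    rw [integral_const_mul, ← integral_mul_heatKernel g (lt_of_lt_of_le ha ht.1) x x',
      ← integral_const_mul]
    refine integral_congr_ae (Eventually.of_forall fun y => ?_)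
    simp only [hG, reflectAt_apply]
    ring
  -- With Parseval applied at each time, integrating in time under the frequency integral produces
  -- the multiplier relating `𝓕 g` to `𝓕 θ`; Fourier inversion at `v` then gives `θ v`.
  rw [setIntegral_congr_fun measurableSet_Icc hinner, integral_integral_swap]
  · have hθv : θ v = ∫ ξ, Complex.exp (2 * Real.pi * Complex.I * (inner ℝ v ξ : ℝ)) * 𝓕 θ ξ := by
      have h0 : 𝓕⁻ (𝓕 θ) = θ := FourierTransform.fourierInv_fourier_eq θ
      rw [← congrArg (fun h : 𝓢(Rn n, ℂ) => h v) h0]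
      rw [fourierInv_coe, Real.fourierInv_eq']
      refine integral_congr_ae (Eventually.of_forall fun ξ => ?_)
      simp only [smul_eq_mul, real_inner_comm]
      congr 2
      push_cast; ring
    rw [hθv]
    refine integral_congr_ae (Eventually.of_forall fun ξ => ?_)
    simp only
    have hw : laplaceSymbol ξ ^ i * laplaceWeight η (laplaceSymbol ξ)
        = ∫ t in Icc a b, iteratedDeriv i η t * Real.exp (-t * laplaceSymbol ξ) := by
      rw [setIntegral_eq_integral_of_forall_compl_eq_zero, integral_iteratedDeriv_mul_exp hη hc]
      intro t ht
      rw [image_eq_zero_of_notMem_tsupport fun h =>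
        ht (hsupp (tsupport_iteratedDeriv_subset_tsupport η i h)), zero_mul]
    rw [hθ ξ, hw, ← integral_complex_ofReal, mul_left_comm, ← integral_const_mul,
      ← integral_const_mul]
    refine integral_congr_ae (Eventually.of_forall fun t => ?_)
    simp only [Complex.exp_add]
    push_cast
    rw [neg_mul]
    ring
  · have h1 : Integrable (fun q : ℝ × Rn n => ‖iteratedDeriv i η q.1‖ * ‖𝓕 g q.2‖)
        ((volume.restrict (Icc a b)).prod volume) :=
      (hηi.integrableOn_Icc.norm).mul_prod ((𝓕 g).integrable (μ := volume)).norm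
    refine h1.mono' ?_ ?_
    · refine Continuous.aestronglyMeasurable ?_
      have := continuous_laplaceSymbol (n := n)
      have h2 := (𝓕 g).continuous
      simp only [Function.uncurry_def]
      fun_prop
    · have : ∀ᵐ q ∂((volume.restrict (Icc a b)).prod (volume : Measure (Rn n))), q.1 ∈ Icc a b :=
        Measure.quasiMeasurePreserving_fst.ae (ae_restrict_mem measurableSet_Icc)
      filter_upwards [this] with q hq
      simp only [Function.uncurry_def]
      rw [norm_mul, norm_mul, Complex.norm_real]
      gcongr
      refine mul_le_of_le_one_right (norm_nonneg _) ?_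
      rw [Complex.norm_exp]
      refine Real.exp_le_one_iff.2 ?_
      have h3 : 0 ≤ q.1 * laplaceSymbol q.2 :=
        mul_nonneg (ha.le.trans hq.1) (laplaceSymbol_nonneg _)
      simpa using h3

/-- Convolutions with a tempered distribution are weighted means of its caloric extension. -/
theorem convDist_eq_integral_caloricExtension {n : ℕ} (f : 𝓢'(Rn n, ℂ)) {g θ : 𝓢(Rn n, ℂ)}
    {η : ℝ → ℝ} (hη : ContDiff ℝ ∞ η) {a b : ℝ} (ha : 0 < a) (hsupp : tsupport η ⊆ Icc a b) (i : ℕ)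
    (hθ : ∀ ξ, 𝓕 θ ξ = 𝓕 g ξ *
      ((laplaceSymbol ξ ^ i * laplaceWeight η (laplaceSymbol ξ) : ℝ) : ℂ)) (x : Rn n) :
    convDist θ f x = ∫ z, (reflectAt g x z.1 * ((iteratedDeriv i η z.2 : ℝ) : ℂ)) * caloricExtension f z
      ∂(slabMeasure n a b) := by
  have hηi : Continuous (iteratedDeriv i η) := hη.continuous_iteratedDeriv i (by exact_mod_cast le_top)
  have hηic : Continuous fun t => ((iteratedDeriv i η t : ℝ) : ℂ) := Complex.continuous_ofReal.comp hηi
  rw [convDist, ← f.integral_apply (μ := slabMeasure n a b) (h := fun z : Rn n × ℝ =>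
    (reflectAt g x z.1 * ((iteratedDeriv i η z.2 : ℝ) : ℂ)) • reflectAt (heatKernel n z.2) z.1)]
  · refine integral_congr_ae (Eventually.of_forall fun z => ?_)
    simp only [map_smul, smul_eq_mul, caloricExtension, convDist]
  -- This makes the Schwartz space pseudometrizable, as strong measurability of a continuous
  -- Schwartz-valued map requires here.
  · have : (uniformity 𝓢(Rn n, ℂ)).IsCountablyGenerated :=
      IsUniformAddGroup.uniformity_countably_generated
    refine aestronglyMeasurable_slabMeasure ha ?_
    refine ContinuousOn.smul (f := fun z : Rn n × ℝ =>
      reflectAt g x z.1 * ((iteratedDeriv i η z.2 : ℝ) : ℂ)) ?_ ?_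
    · exact (((reflectAt g x).continuous.comp continuous_fst).mul
        (hηic.comp continuous_snd)).continuousOn
    · exact continuousOn_reflectAt_heatKernel n
  · intro k l
    obtain ⟨C, hC0, hC⟩ := exists_seminorm_reflectAt_heatKernel_le n k l (b := b) ha
    refine ⟨_, (integrable_slabMeasure_mul (a := a) (b := b)
      ((reflectAt g x).integrable_one_add_norm_pow_mul k) hηi.norm).mul_const C, ?_⟩
    filter_upwards [ae_slabMeasure] with z hz
    rw [map_smul_eq_mul, norm_mul, Complex.norm_real]
    calc _ ≤ ‖reflectAt g x z.1‖ * ‖iteratedDeriv i η z.2‖ * (C * (1 + ‖z.1‖) ^ k) := by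
          gcongr
          exact hC z.1 z.2 hz
      _ = _ := by ring
  · intro x'
    rw [reflectAt_apply, ← integral_slabMeasure_heatKernel hη ha hsupp i hθ x x']
    rfl

end Representation

/-! ### Moving time derivatives from the bump onto the caloric extension -/

section WeakTimeDerivative

open Filter Topology Set

theorem mixedDeriv_zero {n : ℕ} (l : ℕ) (η : Rn n × ℝ → ℝ) :
    mixedDeriv 0 l η = (fun h z => lineDeriv ℝ h z ((0 : Rn n), (1 : ℝ)))^[l] η := by
  unfold mixedDeriv
  induction List.finRange n with
  | nil => rfl
  | cons k L ih => rw [List.foldr_cons, ih]; rfl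

theorem lineDeriv_time_mul {n : ℕ} (χ : Rn n → ℝ) (c : ℝ → ℝ) (z : Rn n × ℝ) :
    lineDeriv ℝ (fun z : Rn n × ℝ => χ z.1 * c z.2) z ((0 : Rn n), (1 : ℝ))
      = χ z.1 * deriv c z.2 := by
  have h : (fun t : ℝ => (fun z : Rn n × ℝ => χ z.1 * c z.2) (z + t • ((0 : Rn n), (1 : ℝ))))
      = fun t => χ z.1 * c (z.2 + t) := by
    funext t
    simp
  rw [lineDeriv, h, deriv_const_mul_field, deriv_comp_const_add, add_zero]

theorem mixedDeriv_zero_mul {n : ℕ} (χ : Rn n → ℝ) (c : ℝ → ℝ) (l : ℕ) :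
    mixedDeriv 0 l (fun z : Rn n × ℝ => χ z.1 * c z.2)
      = fun z => χ z.1 * iteratedDeriv l c z.2 := by
  rw [mixedDeriv_zero]
  induction l generalizing c with
  | zero => simp
  | succ l ih =>
    rw [Function.iterate_succ_apply, iteratedDeriv_succ', ← ih (deriv c)]
    congr 1
    funext z
    exact lineDeriv_time_mul χ c z

theorem slab_subset_strip {n : ℕ} {T : ℝ≥0∞} {a b : ℝ} (ha : 0 < a) (hb : ENNReal.ofReal b < T) :
    (univ : Set (Rn n)) ×ˢ Icc a b ⊆ strip n T := fun _ hz =>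
  ⟨lt_of_lt_of_le ha hz.2.1, lt_of_le_of_lt (ENNReal.ofReal_le_ofReal hz.2.2) hb⟩

theorem measurableSet_strip (n : ℕ) (T : ℝ≥0∞) : MeasurableSet (strip n T) :=
  (measurableSet_lt measurable_const measurable_snd).inter
    (measurableSet_lt (ENNReal.measurable_ofReal.comp measurable_snd) measurable_const)

theorem setIntegral_strip_eq {n : ℕ} {T : ℝ≥0∞} {a b : ℝ} (ha : 0 < a) (hb : ENNReal.ofReal b < T)
    {F : Rn n × ℝ → ℂ} (hF : ∀ z : Rn n × ℝ, z.2 ∉ Icc a b → F z = 0) :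
    ∫ z in strip n T, F z = ∫ z, F z ∂(slabMeasure n a b) := by
  rw [slabMeasure_eq_restrict]
  refine setIntegral_eq_of_subset_of_forall_sdiff_eq_zero (measurableSet_strip n T)
    (slab_subset_strip ha hb) fun z hz => hF z fun h => hz.2 ⟨mem_univ _, h⟩

variable {n : ℕ} {T : ℝ≥0∞} {i : ℕ} {v w : Rn n × ℝ → ℂ} {η : ℝ → ℝ} {a b : ℝ}

/-- The weak time derivative against a product test function. -/
theorem HasWeakDeriv.integral_slab_of_hasCompactSupport (h : HasWeakDeriv (strip n T) 0 i v w)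
    (hη : ContDiff ℝ ∞ η) (ha : 0 < a) (hb : ENNReal.ofReal b < T) (hsupp : tsupport η ⊆ Icc a b)
    {χ : Rn n → ℝ} (hχ : ContDiff ℝ ∞ χ) (hχc : HasCompactSupport χ) :
    ∫ z, (χ z.1 * iteratedDeriv i η z.2) • v z ∂(slabMeasure n a b)
      = (-1) ^ i * ∫ z, (χ z.1 * η z.2) • w z ∂(slabMeasure n a b) := by
  have hts : tsupport (fun z : Rn n × ℝ => χ z.1 * η z.2) ⊆ tsupport χ ×ˢ tsupport η := by
    refine closure_minimal (fun z hz => ?_) ((isClosed_tsupport χ).prod (isClosed_tsupport η))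
    rw [Function.mem_support] at hz
    exact ⟨subset_tsupport _ (left_ne_zero_of_mul hz), subset_tsupport _ (right_ne_zero_of_mul hz)⟩
  have hc : HasCompactSupport η := isCompact_Icc.of_isClosed_subset (isClosed_tsupport η) hsupp
  have key := h.2.2 (fun z => χ z.1 * η z.2)
    ((hχ.comp contDiff_fst).mul (hη.comp contDiff_snd))
    ((hχc.prod hc).of_isClosed_subset (isClosed_tsupport _) hts)
    (hts.trans ((prod_mono (subset_univ _) hsupp).trans (slab_subset_strip ha hb)))
  rw [mixedDeriv_zero_mul] at key
  have hz : ∀ c : ℝ → ℝ, tsupport c ⊆ tsupport η → ∀ u : Rn n × ℝ → ℂ, ∀ z : Rn n × ℝ,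
      z.2 ∉ Icc a b → (χ z.1 * c z.2) • u z = 0 := fun c hc u z hz => by
    rw [image_eq_zero_of_notMem_tsupport (f := c) fun hm => hz (hsupp (hc hm)), mul_zero, zero_smul]
  rw [setIntegral_strip_eq ha hb (hz _ (tsupport_iteratedDeriv_subset_tsupport η i) v),
    setIntegral_strip_eq ha hb (hz _ subset_rfl w)] at key
  simpa using key

/-- Spatial cutoffs `ζ R` reduce this to compactly supported test functions, and dominated
convergence removes them. No derivative falls on a cutoff, since only time is differentiated. -/
theorem HasWeakDeriv.integral_slab_real (h : HasWeakDeriv (strip n T) 0 i v w)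
    (hη : ContDiff ℝ ∞ η) (ha : 0 < a) (hb : ENNReal.ofReal b < T) (hsupp : tsupport η ⊆ Icc a b)
    {q : Rn n → ℝ} (hq : ContDiff ℝ ∞ q)
    (hvi : Integrable (fun z => (q z.1 * iteratedDeriv i η z.2) • v z) (slabMeasure n a b))
    (hwi : Integrable (fun z => (q z.1 * η z.2) • w z) (slabMeasure n a b)) :
    ∫ z, (q z.1 * iteratedDeriv i η z.2) • v z ∂(slabMeasure n a b)
      = (-1) ^ i * ∫ z, (q z.1 * η z.2) • w z ∂(slabMeasure n a b) := by
  let ζ : ℕ → ContDiffBump (0 : Rn n) := fun R => ⟨R + 1, R + 2, by positivity, by linarith⟩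
  have hlim : ∀ F : Rn n × ℝ → ℂ, Integrable F (slabMeasure n a b) →
      Tendsto (fun R => ∫ z, ζ R z.1 • F z ∂(slabMeasure n a b)) atTop
        (𝓝 (∫ z, F z ∂(slabMeasure n a b))) := by
    intro F hF
    refine tendsto_integral_of_dominated_convergence (fun z => ‖F z‖) (fun R => ?_) hF.norm
      (fun R => Eventually.of_forall fun z => ?_) (Eventually.of_forall fun z => ?_)
    · exact ((ζ R).continuous.comp continuous_fst).aestronglyMeasurable.smul
        hF.aestronglyMeasurable
    · rw [norm_smul, Real.norm_of_nonneg (ζ R).nonneg]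
      exact mul_le_of_le_one_left (norm_nonneg _) (ζ R).le_one
    · refine tendsto_const_nhds.congr' ?_
      filter_upwards [eventually_ge_atTop ⌈‖z.1‖⌉₊] with R hR
      rw [(ζ R).one_of_mem_closedBall, one_smul]
      rw [mem_closedBall_zero_iff]
      change ‖z.1‖ ≤ (R : ℝ) + 1
      have := (Nat.le_ceil ‖z.1‖).trans (Nat.cast_le.2 hR)
      linarith
  refine tendsto_nhds_unique (hlim _ hvi) (((hlim _ hwi).const_mul _).congr fun R => ?_)
  have := h.integral_slab_of_hasCompactSupport hη ha hb hsupp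
    (χ := fun y => ζ R y * q y) ((ζ R).contDiff.mul hq) ((ζ R).hasCompactSupport.mul_right)
  simp only [smul_smul, ← mul_assoc]
  exact this.symm

/-- The weak time derivative against the product of a Schwartz function of `x` and a test function
of `t`. -/
theorem HasWeakDeriv.integral_slab (h : HasWeakDeriv (strip n T) 0 i v w)
    (hη : ContDiff ℝ ∞ η) (ha : 0 < a) (hb : ENNReal.ofReal b < T) (hsupp : tsupport η ⊆ Icc a b)
    (G : 𝓢(Rn n, ℂ))
    (hvm : AEStronglyMeasurable v (slabMeasure n a b))
    (hwm : AEStronglyMeasurable w (slabMeasure n a b))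
    (hvi : Integrable (fun z => ‖G z.1‖ * ‖iteratedDeriv i η z.2‖ * ‖v z‖) (slabMeasure n a b))
    (hwi : Integrable (fun z => ‖G z.1‖ * ‖η z.2‖ * ‖w z‖) (slabMeasure n a b)) :
    ∫ z, (G z.1 * ((iteratedDeriv i η z.2 : ℝ) : ℂ)) * v z ∂(slabMeasure n a b)
      = (-1) ^ i * ∫ z, (G z.1 * (η z.2 : ℂ)) * w z ∂(slabMeasure n a b) := by
  have hηi : Continuous (iteratedDeriv i η) :=
    hη.continuous_iteratedDeriv i (by exact_mod_cast le_top)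
  have hre : ContDiff ℝ ∞ fun y => (G y).re := Complex.reCLM.contDiff.comp (G.smooth ⊤)
  have him : ContDiff ℝ ∞ fun y => (G y).im := Complex.imCLM.contDiff.comp (G.smooth ⊤)
  have hint : ∀ (q : Rn n → ℝ) (c : ℝ → ℝ) (u : Rn n × ℝ → ℂ), Continuous q → Continuous c →
      (∀ y, ‖q y‖ ≤ ‖G y‖) → AEStronglyMeasurable u (slabMeasure n a b) →
      Integrable (fun z => ‖G z.1‖ * ‖c z.2‖ * ‖u z‖) (slabMeasure n a b) →
      Integrable (fun z => (q z.1 * c z.2) • u z) (slabMeasure n a b) := by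
    intro q c u hq hc hle hum hui
    refine hui.mono' ?_ (Eventually.of_forall fun z => ?_)
    · exact ((hq.comp continuous_fst).mul (hc.comp continuous_snd)).aestronglyMeasurable.smul hum
    · rw [norm_smul, norm_mul]
      gcongr
      exact hle z.1
  -- Weak derivatives are tested against real functions, so the real and imaginary parts of `G` are
  -- treated separately.
  have hsplit : ∀ (c : ℝ → ℝ) (u : Rn n × ℝ → ℂ), Continuous c →
      AEStronglyMeasurable u (slabMeasure n a b) →
      Integrable (fun z => ‖G z.1‖ * ‖c z.2‖ * ‖u z‖) (slabMeasure n a b) →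
      ∫ z, (G z.1 * (c z.2 : ℂ)) * u z ∂(slabMeasure n a b)
        = ∫ z, ((G z.1).re * c z.2) • u z ∂(slabMeasure n a b)
          + Complex.I * ∫ z, ((G z.1).im * c z.2) • u z ∂(slabMeasure n a b) := by
    intro c u hc hum hui
    rw [← integral_const_mul, ← integral_add
      (hint _ c u hre.continuous hc (fun y => Complex.abs_re_le_norm _) hum hui)
      ((hint _ c u him.continuous hc (fun y => Complex.abs_im_le_norm _) hum hui).const_mul _)]
    refine integral_congr_ae (Eventually.of_forall fun z => ?_)
    simp only [Complex.real_smul, Complex.ofReal_mul]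
    conv_lhs => rw [← Complex.re_add_im (G z.1)]
    ring
  rw [hsplit _ _ hηi hvm hvi, hsplit _ _ hη.continuous hwm hwi,
    h.integral_slab_real hη ha hb hsupp hre
      (hint _ _ v hre.continuous hηi (fun y => Complex.abs_re_le_norm _) hvm hvi)
      (hint _ _ w hre.continuous hη.continuous (fun y => Complex.abs_re_le_norm _) hwm hwi),
    h.integral_slab_real hη ha hb hsupp him
      (hint _ _ v him.continuous hηi (fun y => Complex.abs_im_le_norm _) hvm hvi)
      (hint _ _ w him.continuous hη.continuous (fun y => Complex.abs_im_le_norm _) hwm hwi)]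
  ring

/-- Convolutions with a tempered distribution are weighted means of the weak time derivatives of its
caloric extension. -/
theorem convDist_eq_integral_weakDeriv {f : 𝓢'(Rn n, ℂ)} {g θ : 𝓢(Rn n, ℂ)}
    (h : HasWeakDeriv (strip n T) 0 i (caloricExtension f) w)
    (hη : ContDiff ℝ ∞ η) (ha : 0 < a) (hb : ENNReal.ofReal b < T) (hsupp : tsupport η ⊆ Icc a b)
    (hθ : ∀ ξ, 𝓕 θ ξ = 𝓕 g ξ *
      ((laplaceSymbol ξ ^ i * laplaceWeight η (laplaceSymbol ξ) : ℝ) : ℂ)) (x : Rn n)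
    (hwm : AEStronglyMeasurable w (slabMeasure n a b))
    (hwi : Integrable (fun z => ‖reflectAt g x z.1‖ * ‖η z.2‖ * ‖w z‖) (slabMeasure n a b)) :
    convDist θ f x
      = (-1) ^ i * ∫ z, (reflectAt g x z.1 * (η z.2 : ℂ)) * w z ∂(slabMeasure n a b) := by
  have hηi : Continuous (iteratedDeriv i η) :=
    hη.continuous_iteratedDeriv i (by exact_mod_cast le_top)
  have hum : AEStronglyMeasurable (caloricExtension f) (slabMeasure n a b) :=
    aestronglyMeasurable_slabMeasure ha (continuousOn_caloricExtension f)
  rw [convDist_eq_integral_caloricExtension f hη ha hsupp i hθ x]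
  refine h.integral_slab hη ha hb hsupp (reflectAt g x) hum hwm ?_ hwi
  obtain ⟨C, N, hC0, hC⟩ := exists_norm_caloricExtension_le f (b := b) ha
  refine ((integrable_slabMeasure_mul (a := a) (b := b)
      ((reflectAt g x).integrable_one_add_norm_pow_mul N) hηi.norm).mul_const C).mono' ?_ ?_
  · exact (((reflectAt g x).continuous.comp continuous_fst).norm.mul
      (hηi.comp continuous_snd).norm).aestronglyMeasurable.mul hum.norm
  · filter_upwards [ae_slabMeasure] with z hz
    rw [norm_mul, norm_mul, norm_norm, norm_norm, norm_norm]
    calc _ ≤ ‖reflectAt g x z.1‖ * ‖iteratedDeriv i η z.2‖ * (C * (1 + ‖z.1‖) ^ N) := by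
          gcongr
          exact hC z hz
      _ = _ := by ring

end WeakTimeDerivative

/-! ### Lebesgue norm bounds for the averages -/

section LpBound

open Filter Topology Set

/-- Hölder's inequality applied to the splitting `k F = k^(1 - 1/q) (k F^q)^(1/q)`. -/
theorem ENNReal.lintegral_mul_rpow_le {α : Type*} [MeasurableSpace α] {μ : Measure α}
    {k F : α → ℝ≥0∞} (hk : AEMeasurable k μ) (hF : AEMeasurable F μ) {q : ℝ} (hq : 1 ≤ q) :
    (∫⁻ x, k x * F x ∂μ) ^ q ≤ (∫⁻ x, k x ∂μ) ^ (q - 1) * ∫⁻ x, k x * F x ^ q ∂μ := by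
  have hq0 : 0 < q := by linarith
  have h1 : ∀ x, k x * F x = k x ^ (1 - q⁻¹) * (k x * F x ^ q) ^ q⁻¹ := by
    intro x
    rw [ENNReal.mul_rpow_of_nonneg _ _ (by positivity), ← ENNReal.rpow_mul,
      mul_inv_cancel₀ hq0.ne', ENNReal.rpow_one, ← mul_assoc]
    congr 1
    rw [← ENNReal.rpow_add_of_nonneg _ _ (by simpa using inv_le_one_of_one_le₀ hq)
      (by positivity), sub_add_cancel, ENNReal.rpow_one]
  have h2 := ENNReal.lintegral_mul_norm_pow_le hk (hk.mul (hF.pow_const q))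
    (p := 1 - q⁻¹) (q := q⁻¹) (by simpa using inv_le_one_of_one_le₀ hq) (by positivity) (by ring)
  calc (∫⁻ x, k x * F x ∂μ) ^ q
      ≤ ((∫⁻ x, k x ∂μ) ^ (1 - q⁻¹) * (∫⁻ x, k x * F x ^ q ∂μ) ^ q⁻¹) ^ q := by
        refine ENNReal.rpow_le_rpow ?_ hq0.le
        calc ∫⁻ x, k x * F x ∂μ = ∫⁻ x, k x ^ (1 - q⁻¹) * (k x * F x ^ q) ^ q⁻¹ ∂μ :=
              lintegral_congr h1
          _ ≤ _ := h2
    _ = _ := by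
        rw [ENNReal.mul_rpow_of_nonneg _ _ hq0.le, ← ENNReal.rpow_mul, ← ENNReal.rpow_mul,
          inv_mul_cancel₀ hq0.ne', ENNReal.rpow_one]
        congr 2
        field_simp

instance (n : ℕ) (a b : ℝ) : SFinite (slabMeasure n a b) := by
  unfold slabMeasure; infer_instance

theorem slabMeasure_le_restrict_strip {n : ℕ} {T : ℝ≥0∞} {a b : ℝ} (ha : 0 < a)
    (hb : ENNReal.ofReal b < T) : slabMeasure n a b ≤ volume.restrict (strip n T) := by
  rw [slabMeasure_eq_restrict]
  exact Measure.restrict_mono (slab_subset_strip ha hb) le_rfl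

variable {n : ℕ} {T : ℝ≥0∞} {i : ℕ} {w : Rn n × ℝ → ℂ} {η : ℝ → ℝ} {a b : ℝ}
  {f : 𝓢'(Rn n, ℂ)} {g θ : 𝓢(Rn n, ℂ)}

theorem HasWeakDeriv.aestronglyMeasurable_slab {β : Fin n → ℕ} {v : Rn n × ℝ → ℂ}
    (h : HasWeakDeriv (strip n T) β i v w) (ha : 0 < a) (hb : ENNReal.ofReal b < T) :
    AEStronglyMeasurable w (slabMeasure n a b) :=
  h.2.1.aestronglyMeasurable.mono_measure (slabMeasure_le_restrict_strip ha hb)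

theorem lintegral_enorm_reflectAt (g : 𝓢(Rn n, ℂ)) (x : Rn n) :
    ∫⁻ y, ‖reflectAt g x y‖ₑ = ∫⁻ y, ‖g y‖ₑ := by
  simp_rw [reflectAt_apply]
  exact lintegral_sub_left_eq_self (fun y => ‖g y‖ₑ) x

theorem lintegral_kernel (hη : Continuous η) (g : 𝓢(Rn n, ℂ)) (x : Rn n) :
    ∫⁻ z, ‖reflectAt g x z.1‖ₑ * ‖η z.2‖ₑ ∂(slabMeasure n a b)
      = (∫⁻ y, ‖g y‖ₑ) * ∫⁻ t in Icc a b, ‖η t‖ₑ := by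
  rw [slabMeasure, lintegral_prod_mul (f := fun y => ‖reflectAt g x y‖ₑ) (g := fun t => ‖η t‖ₑ)
    (reflectAt g x).continuous.enorm.aemeasurable hη.enorm.aemeasurable,
    lintegral_enorm_reflectAt]

theorem aemeasurable_kernel (hη : Continuous η) (g : 𝓢(Rn n, ℂ)) (x : Rn n)
    (μ : Measure (Rn n × ℝ)) :
    AEMeasurable (fun z : Rn n × ℝ => ‖reflectAt g x z.1‖ₑ * ‖η z.2‖ₑ) μ :=
  (((reflectAt g x).continuous.comp continuous_fst).enorm.measurable.mul
    (hη.comp continuous_snd).enorm.measurable).aemeasurable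

theorem enorm_convDist_le (h : HasWeakDeriv (strip n T) 0 i (caloricExtension f) w)
    (hη : ContDiff ℝ ∞ η) (ha : 0 < a) (hb : ENNReal.ofReal b < T) (hsupp : tsupport η ⊆ Icc a b)
    (hθ : ∀ ξ, 𝓕 θ ξ = 𝓕 g ξ *
      ((laplaceSymbol ξ ^ i * laplaceWeight η (laplaceSymbol ξ) : ℝ) : ℂ)) (x : Rn n) :
    ‖convDist θ f x‖ₑ
      ≤ ∫⁻ z, (‖reflectAt g x z.1‖ₑ * ‖η z.2‖ₑ) * ‖w z‖ₑ ∂(slabMeasure n a b) := by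
  have hwm := h.aestronglyMeasurable_slab ha hb
  -- An infinite right side is harmless; a finite one is exactly the integrability that the
  -- representation formula needs.
  by_cases htop : ∫⁻ z, (‖reflectAt g x z.1‖ₑ * ‖η z.2‖ₑ) * ‖w z‖ₑ ∂(slabMeasure n a b) = ⊤
  · rw [htop]; exact le_top
  have hwi : Integrable (fun z => ‖reflectAt g x z.1‖ * ‖η z.2‖ * ‖w z‖) (slabMeasure n a b) := by
    refine ⟨((((reflectAt g x).continuous.comp continuous_fst).norm.mul
      (hη.continuous.comp continuous_snd).norm).aestronglyMeasurable).mul hwm.norm, ?_⟩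
    simpa [HasFiniteIntegral, enorm_mul, lt_top_iff_ne_top] using htop
  rw [convDist_eq_integral_weakDeriv h hη ha hb hsupp hθ x hwm hwi, enorm_mul, enorm_pow]
  simp only [enorm_neg, enorm_one, one_pow, one_mul]
  refine (enorm_integral_le_lintegral_enorm _).trans (lintegral_mono fun z => ?_)
  rw [enorm_mul, enorm_mul]
  gcongr
  rw [← ofReal_norm, ← ofReal_norm, Complex.norm_real]

/-- The `L^∞` bound of a convolution by a weak time derivative of the caloric extension. -/
theorem eLpNorm_top_convDist_le (h : HasWeakDeriv (strip n T) 0 i (caloricExtension f) w)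
    (hη : ContDiff ℝ ∞ η) (ha : 0 < a) (hb : ENNReal.ofReal b < T) (hsupp : tsupport η ⊆ Icc a b)
    (hθ : ∀ ξ, 𝓕 θ ξ = 𝓕 g ξ *
      ((laplaceSymbol ξ ^ i * laplaceWeight η (laplaceSymbol ξ) : ℝ) : ℂ)) :
    eLpNorm (convDist θ f) ⊤ volume ≤ (∫⁻ y, ‖g y‖ₑ) * (∫⁻ t in Icc a b, ‖η t‖ₑ) *
      eLpNorm w ⊤ (volume.restrict (strip n T)) := by
  rw [eLpNorm_exponent_top, eLpNorm_exponent_top]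
  refine eLpNormEssSup_le_of_ae_enorm_bound (Eventually.of_forall fun x => ?_)
  refine (enorm_convDist_le h hη ha hb hsupp hθ x).trans ?_
  rw [← lintegral_kernel hη.continuous g x, ← lintegral_mul_const'' _
    (aemeasurable_kernel hη.continuous g x _)]
  refine lintegral_mono_ae ?_
  have hle : ∀ᵐ z ∂(slabMeasure n a b), ‖w z‖ₑ ≤ eLpNormEssSup w (volume.restrict (strip n T)) :=
    (Measure.absolutelyContinuous_of_le (slabMeasure_le_restrict_strip ha hb)).ae_le
      (enorm_ae_le_eLpNormEssSup w _)
  filter_upwards [hle] with z hz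
  gcongr

/-- The `L^q` bound of a convolution by a weak time derivative of the caloric extension. -/
theorem lintegral_convDist_rpow_le (h : HasWeakDeriv (strip n T) 0 i (caloricExtension f) w)
    (hη : ContDiff ℝ ∞ η) (ha : 0 < a) (hb : ENNReal.ofReal b < T) (hsupp : tsupport η ⊆ Icc a b)
    (hθ : ∀ ξ, 𝓕 θ ξ = 𝓕 g ξ *
      ((laplaceSymbol ξ ^ i * laplaceWeight η (laplaceSymbol ξ) : ℝ) : ℂ)) {q : ℝ} (hq : 1 ≤ q)
    {M : ℝ≥0∞} (hM : ∀ t, ‖η t‖ₑ ≤ M) :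
    ∫⁻ x, ‖convDist θ f x‖ₑ ^ q ≤
      ((∫⁻ y, ‖g y‖ₑ) * ∫⁻ t in Icc a b, ‖η t‖ₑ) ^ (q - 1) *
        ((∫⁻ y, ‖g y‖ₑ) * (M * ∫⁻ z, ‖w z‖ₑ ^ q ∂(slabMeasure n a b))) := by
  have hwm := h.aestronglyMeasurable_slab ha hb
  have hk : ∀ x, AEMeasurable (fun z : Rn n × ℝ => ‖reflectAt g x z.1‖ₑ * ‖η z.2‖ₑ)
      (slabMeasure n a b) := fun x =>
    ((((reflectAt g x).continuous.comp continuous_fst).enorm.measurable.mul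
      (hη.continuous.comp continuous_snd).enorm.measurable).aemeasurable)
  have hpt : ∀ x, ‖convDist θ f x‖ₑ ^ q ≤
      ((∫⁻ y, ‖g y‖ₑ) * ∫⁻ t in Icc a b, ‖η t‖ₑ) ^ (q - 1) *
        ∫⁻ z, (‖reflectAt g x z.1‖ₑ * ‖η z.2‖ₑ) * ‖w z‖ₑ ^ q ∂(slabMeasure n a b) := by
    intro x
    refine (ENNReal.rpow_le_rpow (enorm_convDist_le h hη ha hb hsupp hθ x)
      (by linarith)).trans ?_
    refine (ENNReal.lintegral_mul_rpow_le (hk x) hwm.enorm hq).trans ?_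
    rw [lintegral_kernel hη.continuous]
  have hmeas : AEMeasurable (fun p : Rn n × (Rn n × ℝ) =>
      (‖reflectAt g p.1 p.2.1‖ₑ * ‖η p.2.2‖ₑ) * ‖w p.2‖ₑ ^ q)
      (volume.prod (slabMeasure n a b)) := by
    simp_rw [reflectAt_apply]
    refine AEMeasurable.mul ?_ (hwm.enorm.pow_const q).comp_snd
    have h1 : Measurable fun p : Rn n × (Rn n × ℝ) => ‖g (p.1 - p.2.1)‖ₑ :=
      (g.continuous.comp (continuous_fst.sub (continuous_fst.comp continuous_snd))).enorm.measurable
    have h2 : Measurable fun p : Rn n × (Rn n × ℝ) => ‖η p.2.2‖ₑ :=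
      (hη.continuous.comp (continuous_snd.comp continuous_snd)).enorm.measurable
    exact (h1.mul h2).aemeasurable
  calc ∫⁻ x, ‖convDist θ f x‖ₑ ^ q
      ≤ ∫⁻ x, ((∫⁻ y, ‖g y‖ₑ) * ∫⁻ t in Icc a b, ‖η t‖ₑ) ^ (q - 1) *
        ∫⁻ z, (‖reflectAt g x z.1‖ₑ * ‖η z.2‖ₑ) * ‖w z‖ₑ ^ q ∂(slabMeasure n a b) :=
        lintegral_mono hpt
    _ = ((∫⁻ y, ‖g y‖ₑ) * ∫⁻ t in Icc a b, ‖η t‖ₑ) ^ (q - 1) *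
        ∫⁻ x, ∫⁻ z, (‖reflectAt g x z.1‖ₑ * ‖η z.2‖ₑ) * ‖w z‖ₑ ^ q ∂(slabMeasure n a b) :=
        lintegral_const_mul'' _ hmeas.lintegral_prod_right'
    _ ≤ _ := by
        gcongr
        -- Integrating in `x` first leaves the `L¹` norm of `g`. The integral of `‖w‖ₑ ^ q` stays on
        -- the slab, so that disjoint slabs can be summed later.
        rw [lintegral_lintegral_swap hmeas]
        calc ∫⁻ z, (∫⁻ x, (‖reflectAt g x z.1‖ₑ * ‖η z.2‖ₑ) * ‖w z‖ₑ ^ q) ∂(slabMeasure n a b)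
            = ∫⁻ z, (∫⁻ y, ‖g y‖ₑ) * (‖η z.2‖ₑ * ‖w z‖ₑ ^ q) ∂(slabMeasure n a b) := by
              refine lintegral_congr fun z => ?_
              simp_rw [mul_assoc, reflectAt_apply]
              rw [lintegral_mul_const _ (by
                exact (g.continuous.comp (continuous_id.sub continuous_const)).enorm.measurable)]
              congr 1
              exact lintegral_sub_right_eq_self (fun y => ‖g y‖ₑ) z.1
          _ ≤ ∫⁻ z, (∫⁻ y, ‖g y‖ₑ) * (M * ‖w z‖ₑ ^ q) ∂(slabMeasure n a b) := by
              gcongr with z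
              exact hM z.2
          _ = _ := by
              rw [lintegral_const_mul'' _ ((hwm.enorm.pow_const q).const_mul M),
                lintegral_const_mul'' _ (hwm.enorm.pow_const q)]

end LpBound

/-! ### Dividing by the multipliers, with bounds uniform in the power -/

section Multipliers

open Filter Topology Set

theorem hasDerivAt_laplaceWeight {η : ℝ → ℝ} (hη : Continuous η) (hc : HasCompactSupport η) (r : ℝ) :
    HasDerivAt (laplaceWeight η) (laplaceWeight (fun t => -t * η t) r) r := by
  have hF : ∀ r : ℝ, Integrable fun t => η t * Real.exp (-t * r) := fun r =>
    (hη.mul (by fun_prop)).integrable_of_hasCompactSupport hc.mul_right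
  have hF' : ∀ r : ℝ, Integrable fun t => -t * η t * Real.exp (-t * r) := fun r =>
    ((continuous_neg.mul hη).mul (by fun_prop)).integrable_of_hasCompactSupport
      (HasCompactSupport.mul_right hc.mul_left)
  have hb : Integrable fun t => |t| * |η t| * Real.exp (|t| * (|r| + 1)) := by
    refine ((continuous_abs.mul hη.abs).mul (by fun_prop)).integrable_of_hasCompactSupport
      (HasCompactSupport.mul_right (HasCompactSupport.mul_left ?_))
    exact hc.comp_left (g := fun x => |x|) abs_zero
  refine (hasDerivAt_integral_of_dominated_loc_of_deriv_le
    (F := fun r t => η t * Real.exp (-t * r)) (F' := fun r t => -t * η t * Real.exp (-t * r))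
    (Metric.ball_mem_nhds r one_pos)
    (Eventually.of_forall fun r => (hF r).aestronglyMeasurable) (hF r)
    (hF' r).aestronglyMeasurable (Eventually.of_forall fun t s hs => ?_) hb
    (Eventually.of_forall fun t s _ => ?_)).2
  · rw [norm_mul, norm_mul, norm_neg, Real.norm_of_nonneg (Real.exp_pos _).le, Real.norm_eq_abs,
      Real.norm_eq_abs]
    refine mul_le_mul_of_nonneg_left (Real.exp_le_exp.2 ((le_abs_self _).trans ?_))
      (by positivity)
    rw [abs_mul, abs_neg]
    gcongr
    have h1 : |s - r| < 1 := by simpa [Real.dist_eq] using hs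
    have h2 := abs_add_le (s - r) r
    rw [sub_add_cancel] at h2
    linarith
  · have h1 : HasDerivAt (fun s : ℝ => Real.exp (-t * s)) (Real.exp (-t * s) * (-t)) s := by
      simpa using ((hasDerivAt_id s).const_mul (-t)).exp
    refine (h1.const_mul (η t)).congr_deriv ?_
    ring

theorem contDiff_laplaceWeight {η : ℝ → ℝ} (hη : Continuous η) (hc : HasCompactSupport η) :
    ContDiff ℝ ∞ (laplaceWeight η) := by
  refine contDiff_infty.2 fun m => ?_
  induction m generalizing η with
  | zero =>
    rw [Nat.cast_zero, contDiff_zero, continuous_iff_continuousAt]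
    exact fun r => (hasDerivAt_laplaceWeight hη hc r).continuousAt
  | succ m ih =>
    rw [Nat.cast_add, Nat.cast_one, contDiff_succ_iff_deriv]
    refine ⟨fun r => (hasDerivAt_laplaceWeight hη hc r).differentiableAt, by simp, ?_⟩
    have : deriv (laplaceWeight η) = laplaceWeight fun t => -t * η t :=
      funext fun r => (hasDerivAt_laplaceWeight hη hc r).deriv
    rw [this]
    exact ih (continuous_neg.mul hη) hc.mul_left

theorem laplaceWeight_pos {η : ℝ → ℝ} (hη : Continuous η) (hc : HasCompactSupport η)
    (h0 : ∀ t, 0 ≤ η t) {t₀ : ℝ} (ht₀ : η t₀ ≠ 0) (r : ℝ) : 0 < laplaceWeight η r := by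
  have hcont : Continuous fun t => η t * Real.exp (-t * r) := hη.mul (by fun_prop)
  exact hcont.integral_pos_of_hasCompactSupport_nonneg_nonzero hc.mul_right
    (fun t => mul_nonneg (h0 t) (Real.exp_pos _).le)
    (mul_ne_zero ht₀ (Real.exp_pos _).ne')

theorem contDiff_laplaceSymbol {n : ℕ} : ContDiff ℝ ∞ (laplaceSymbol (n := n)) :=
  contDiff_const.mul (contDiff_norm_sq ℝ)

/-- Division of a compactly supported Schwartz function by a nonvanishing smooth function. -/
theorem exists_schwartz_eq_mul {n : ℕ} (h : 𝓢(Rn n, ℂ)) (hh : HasCompactSupport h)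
    {m : Rn n → ℝ} (hm : ContDiff ℝ ∞ m) (h0 : ∀ ξ, m ξ ≠ 0) :
    ∃ k : 𝓢(Rn n, ℂ), tsupport k ⊆ tsupport h ∧ ∀ ξ, h ξ = k ξ * (m ξ : ℂ) := by
  have hs : ContDiff ℝ ∞ fun ξ => (m ξ)⁻¹ • h ξ := (hm.inv h0).smul (h.smooth ⊤)
  have hc : HasCompactSupport fun ξ => (m ξ)⁻¹ • h ξ :=
    hh.of_isClosed_subset (isClosed_tsupport _) (tsupport_smul_subset_right _ _)
  refine ⟨hc.toSchwartzMap hs, tsupport_smul_subset_right _ _, fun ξ => ?_⟩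
  change h ξ = (m ξ)⁻¹ • h ξ * (m ξ : ℂ)
  rw [Complex.real_smul, Complex.ofReal_inv, mul_right_comm,
    inv_mul_cancel₀ (by exact_mod_cast h0 ξ), one_mul]

/-- A smooth function equal to the reciprocal of `laplaceSymbol` away from the origin. -/
theorem exists_contDiff_eq_inv_laplaceSymbol (n : ℕ) : ∃ ρ : Rn n → ℝ, ContDiff ℝ ∞ ρ ∧
    ∀ ξ, 4⁻¹ ≤ ‖ξ‖ → ρ ξ = (laplaceSymbol ξ)⁻¹ := by
  let b : ContDiffBump (0 : Rn n) := ⟨8⁻¹, 4⁻¹, by norm_num, by norm_num⟩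
  refine ⟨fun ξ => (1 - b ξ) * (laplaceSymbol ξ)⁻¹, ?_, fun ξ hξ => ?_⟩
  · rw [contDiff_iff_contDiffAt]
    intro ξ
    -- Near the origin `1 - b` vanishes identically, so the singularity of the reciprocal is
    -- invisible.
    by_cases h : ξ = 0
    · subst h
      refine (contDiffAt_const (c := (0 : ℝ))).congr_of_eventuallyEq ?_
      filter_upwards [b.eventuallyEq_one] with ξ hξ
      rw [hξ]; simp
    · refine (contDiff_const.sub b.contDiff).contDiffAt.mul (contDiff_laplaceSymbol.contDiffAt.inv ?_)
      have := norm_pos_iff.2 h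
      unfold laplaceSymbol; positivity
  · simp only
    rw [b.zero_of_le_dist (by simpa using hξ), sub_zero, one_mul]

theorem exists_pow_mul_two_inv_pow_le (m : ℕ) : ∃ C : ℝ, 0 ≤ C ∧
    ∀ i : ℕ, (i : ℝ) ^ m * (2⁻¹ : ℝ) ^ i ≤ C := by
  have h := tendsto_pow_const_mul_const_pow_of_abs_lt_one m (r := (2⁻¹ : ℝ))
    (by rw [abs_of_pos] <;> norm_num)
  obtain ⟨C, hC⟩ := h.bddAbove_range
  exact ⟨C, le_trans (by positivity) (hC ⟨0, rfl⟩), fun i => hC ⟨i, rfl⟩⟩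

/-- The `m`-th derivative of `y ^ i` costs a factor at most `i ^ m`, which the geometric decay of
`|x| ^ (i - m)` absorbs. This is where uniformity in `i` originates. -/
theorem exists_norm_iteratedFDeriv_pow_le (k : ℕ) : ∃ C : ℝ, 0 ≤ C ∧
    ∀ (i : ℕ) (x : ℝ), |x| ≤ 2⁻¹ → ∀ m ≤ k, ‖iteratedFDeriv ℝ m (fun y : ℝ => y ^ i) x‖ ≤ C := by
  choose C hC0 hC using exists_pow_mul_two_inv_pow_le
  refine ⟨∑ m ∈ Finset.range (k + 1), 2 ^ m * C m, Finset.sum_nonneg fun m _ =>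
    mul_nonneg (by positivity) (hC0 m), fun i x hx m hm => ?_⟩
  refine le_trans ?_ (Finset.single_le_sum (f := fun m => 2 ^ m * C m)
    (fun m _ => mul_nonneg (by positivity) (hC0 m)) (Finset.mem_range.2 (Nat.lt_succ_of_le hm)))
  rw [norm_iteratedFDeriv_eq_norm_iteratedDeriv, iteratedDeriv_eq_iterate, iter_deriv_pow]
  by_cases him : i < m
  · rw [Finset.prod_eq_zero (Finset.mem_range.2 him) (sub_self _), zero_mul, norm_zero]
    exact mul_nonneg (by positivity) (hC0 m)
  · push Not at him
    rw [norm_mul, norm_pow, Real.norm_eq_abs x, norm_prod]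
    calc (∏ j ∈ Finset.range m, ‖(i : ℝ) - j‖) * |x| ^ (i - m)
        ≤ (i : ℝ) ^ m * (2⁻¹ : ℝ) ^ (i - m) := by
          gcongr
          refine (Finset.prod_le_prod (g := fun _ => (i : ℝ)) (fun _ _ => norm_nonneg _)
            fun j hj => ?_).trans_eq (by simp)
          have hj' : (j : ℝ) ≤ i := by
            exact_mod_cast (Finset.mem_range.1 hj).le.trans him
          rw [Real.norm_of_nonneg (by linarith)]
          linarith [(Nat.cast_nonneg j : (0 : ℝ) ≤ j)]
      _ = 2 ^ m * ((i : ℝ) ^ m * (2⁻¹ : ℝ) ^ i) := by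
          rw [← Nat.sub_add_cancel him, pow_add, Nat.add_sub_cancel]
          have : (2 : ℝ) ^ m * (2⁻¹ : ℝ) ^ m = 1 := by rw [← mul_pow]; norm_num
          rw [show (2 : ℝ) ^ m * ((↑(i - m + m) : ℝ) ^ m * (2⁻¹ ^ (i - m) * 2⁻¹ ^ m))
            = (↑(i - m + m) : ℝ) ^ m * 2⁻¹ ^ (i - m) * (2 ^ m * 2⁻¹ ^ m) by ring, this, mul_one]
      _ ≤ 2 ^ m * C m := by
          gcongr
          exact hC m i

theorem exists_bound_iteratedFDeriv_pow_comp {n : ℕ} {ρ : Rn n → ℝ} (hρ : ContDiff ℝ ∞ ρ)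
    {K : Set (Rn n)} (hK : IsCompact K) (hρK : ∀ x ∈ K, |ρ x| ≤ 2⁻¹) (k : ℕ) : ∃ C : ℝ, 0 ≤ C ∧
    ∀ (i : ℕ), ∀ x ∈ K, ‖iteratedFDeriv ℝ k (fun y => ρ y ^ i) x‖ ≤ C := by
  obtain ⟨A, hA0, hA⟩ := exists_norm_iteratedFDeriv_pow_le k
  have hD : ∀ m : ℕ, ∃ D, ∀ x ∈ K, ‖iteratedFDeriv ℝ m ρ x‖ ≤ D := fun m =>
    hK.exists_bound_of_continuousOn
      (hρ.continuous_iteratedFDeriv (by exact_mod_cast le_top)).continuousOn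
  choose D hD using hD
  -- The summand `1` ensures `D' ≤ D' ^ m`, the form demanded by the bound for derivatives of a
  -- composition.
  set D' : ℝ := 1 + ∑ m ∈ Finset.range (k + 1), |D m| with hD'
  have hs : 0 ≤ ∑ m ∈ Finset.range (k + 1), |D m| := Finset.sum_nonneg fun _ _ => abs_nonneg _
  refine ⟨k.factorial * A * D' ^ k, by positivity, fun i x hx => ?_⟩
  refine norm_iteratedFDeriv_comp_le (g := fun y : ℝ => y ^ i) (f := ρ) (N := ∞)
    (contDiff_id.pow i) hρ (by exact_mod_cast le_top) x (fun m hm => hA i _ (hρK x hx) m hm)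
    fun m hm1 hmk => ?_
  calc ‖iteratedFDeriv ℝ m ρ x‖ ≤ |D m| := (hD m x hx).trans (le_abs_self _)
    _ ≤ ∑ m ∈ Finset.range (k + 1), |D m| := Finset.single_le_sum (f := fun m => |D m|)
        (fun _ _ => abs_nonneg _) (Finset.mem_range.2 (Nat.lt_succ_of_le hmk))
    _ ≤ D' := by linarith
    _ ≤ D' ^ m := le_self_pow₀ (by linarith) (by omega)

theorem exists_seminorm_pow_smul_le {n : ℕ} {ρ : Rn n → ℝ} (hρ : ContDiff ℝ ∞ ρ) (h : 𝓢(Rn n, ℂ))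
    (hc : HasCompactSupport h) (hρK : ∀ x ∈ tsupport h, |ρ x| ≤ 2⁻¹) (k l : ℕ) : ∃ C : ℝ, 0 ≤ C ∧
    ∀ (i : ℕ) (F : 𝓢(Rn n, ℂ)), (∀ x, F x = ρ x ^ i • h x) → SchwartzMap.seminorm ℂ k l F ≤ C := by
  choose C hC0 hC using exists_bound_iteratedFDeriv_pow_comp hρ hc hρK
  refine ⟨∑ j ∈ Finset.range (l + 1), (l.choose j : ℝ) * C j * SchwartzMap.seminorm ℂ k (l - j) h,
    Finset.sum_nonneg fun j _ => mul_nonneg (mul_nonneg (by positivity) (hC0 j)) (apply_nonneg _ _),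
    fun i F hF => ?_⟩
  refine seminorm_le_bound ℂ k l F (Finset.sum_nonneg fun j _ =>
    mul_nonneg (mul_nonneg (by positivity) (hC0 j)) (apply_nonneg _ _)) fun x => ?_
  have hFe : (F : Rn n → ℂ) = fun y => ρ y ^ i • h y := funext hF
  rw [hFe]
  by_cases hx : x ∈ tsupport h
  · calc ‖x‖ ^ k * ‖iteratedFDeriv ℝ l (fun y => ρ y ^ i • h y) x‖
        ≤ ‖x‖ ^ k * ∑ j ∈ Finset.range (l + 1), (l.choose j : ℝ) *
          ‖iteratedFDeriv ℝ j (fun y => ρ y ^ i) x‖ * ‖iteratedFDeriv ℝ (l - j) h x‖ := by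
          gcongr
          exact norm_iteratedFDeriv_smul_le (hρ.pow i) (h.smooth ⊤) x (by exact_mod_cast le_top)
      _ = ∑ j ∈ Finset.range (l + 1), (l.choose j : ℝ) *
          ‖iteratedFDeriv ℝ j (fun y => ρ y ^ i) x‖ *
            (‖x‖ ^ k * ‖iteratedFDeriv ℝ (l - j) h x‖) := by
          rw [Finset.mul_sum]
          exact Finset.sum_congr rfl fun j _ => by ring
      _ ≤ _ := by
          refine Finset.sum_le_sum fun j _ => ?_
          have h1 := hC j i x hx
          have h2 := le_seminorm ℂ k (l - j) h x
          have h3 := hC0 j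
          gcongr
  · have : x ∉ tsupport (iteratedFDeriv ℝ l (fun y => ρ y ^ i • h y)) := fun hm =>
      hx (tsupport_smul_subset_right _ _ (tsupport_iteratedFDeriv_subset l hm))
    rw [image_eq_zero_of_notMem_tsupport this, norm_zero, mul_zero]
    exact Finset.sum_nonneg fun j _ =>
      mul_nonneg (mul_nonneg (by positivity) (hC0 j)) (apply_nonneg _ _)

/-- The `L¹` norm of an inverse Fourier transform is bounded by Schwartz seminorms. -/
theorem exists_lintegral_enorm_le_seminorm (n : ℕ) : ∃ (s : Finset (ℕ × ℕ)) (C : ℝ≥0),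
    ∀ k : 𝓢(Rn n, ℂ), ∫⁻ x, ‖k x‖ₑ
      ≤ ENNReal.ofReal (C * s.sup (schwartzSeminormFamily ℂ (Rn n) ℂ) (𝓕 k)) := by
  let L : 𝓢(Rn n, ℂ) →L[ℂ] Lp ℂ 1 (volume : Measure (Rn n)) :=
    (toLpCLM ℂ ℂ 1 volume).comp (FourierTransform.fourierInvCLM ℂ 𝓢(Rn n, ℂ))
  obtain ⟨s, C, -, h⟩ := Seminorm.bound_of_continuous (schwartz_withSeminorms ℂ (Rn n) ℂ)
    ((normSeminorm ℂ (Lp ℂ 1 (volume : Measure (Rn n)))).comp L.toLinearMap) (by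
      change Continuous fun g => ‖L g‖
      exact L.continuous.norm)
  refine ⟨s, C, fun k => ?_⟩
  have h1 : ‖L (𝓕 k)‖ = (eLpNorm k 1 volume).toReal := by
    have : L (𝓕 k) = k.toLp 1 volume := by
      change (𝓕⁻ (𝓕 k)).toLp 1 volume = k.toLp 1 volume
      rw [FourierTransform.fourierInv_fourier_eq]
    rw [this, norm_toLp]
  rw [← eLpNorm_one_eq_lintegral_enorm, ← ENNReal.ofReal_toReal (k.eLpNorm_lt_top 1 volume).ne, ← h1]
  exact ENNReal.ofReal_le_ofReal (h (𝓕 k))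

/-- Division of a band-limited Schwartz function by powers of the Laplacian, with an `L¹` bound
uniform in the power. -/
theorem exists_fourier_eq_mul_laplaceSymbol_pow {n : ℕ} (h : 𝓢(Rn n, ℂ))
    (hc : HasCompactSupport h) (hsupp : ∀ ξ ∈ tsupport h, 2⁻¹ ≤ ‖ξ‖) :
    ∃ C : ℝ≥0, ∀ i : ℕ, ∃ k : 𝓢(Rn n, ℂ),
      (∀ ξ, h ξ = 𝓕 k ξ * ((laplaceSymbol ξ ^ i : ℝ) : ℂ)) ∧ ∫⁻ x, ‖k x‖ₑ ≤ C := by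
  obtain ⟨ρ, hρ, hρe⟩ := exists_contDiff_eq_inv_laplaceSymbol n
  -- On `‖ξ‖ ≥ 1/2` the symbol is at least `π² > 9`, so its reciprocal lies in the range where
  -- powers have uniformly bounded derivatives.
  have hsym : ∀ ξ ∈ tsupport h, 2 ≤ laplaceSymbol ξ := fun ξ hξ => by
    have h1 := hsupp ξ hξ
    have h2 : 3 < Real.pi := Real.pi_gt_three
    unfold laplaceSymbol
    have h3 : (2⁻¹ : ℝ) ^ 2 ≤ ‖ξ‖ ^ 2 := by gcongr
    nlinarith
  have hρK : ∀ ξ ∈ tsupport h, |ρ ξ| ≤ 2⁻¹ := fun ξ hξ => by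
    have := hsym ξ hξ
    rw [hρe ξ (le_trans (by norm_num) (hsupp ξ hξ)), abs_of_nonneg (by positivity)]
    gcongr
  obtain ⟨s, C, hL⟩ := exists_lintegral_enorm_le_seminorm n
  choose D hD0 hD using exists_seminorm_pow_smul_le hρ h hc hρK
  refine ⟨(C * ∑ a ∈ s, D a.1 a.2).toNNReal, fun i => ?_⟩
  have hs : ContDiff ℝ ∞ fun ξ => ρ ξ ^ i • h ξ := (hρ.pow i).smul (h.smooth ⊤)
  have hci : HasCompactSupport fun ξ => ρ ξ ^ i • h ξ :=
    hc.of_isClosed_subset (isClosed_tsupport _) (tsupport_smul_subset_right _ _)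
  have hk : 𝓕 (𝓕⁻ (hci.toSchwartzMap hs)) = hci.toSchwartzMap hs :=
    FourierTransform.fourier_fourierInv_eq _
  refine ⟨𝓕⁻ (hci.toSchwartzMap hs), fun ξ => ?_, (hL _).trans ?_⟩
  · rw [hk]
    change h ξ = ρ ξ ^ i • h ξ * ((laplaceSymbol ξ ^ i : ℝ) : ℂ)
    by_cases hξ : ξ ∈ tsupport h
    · have h2 := hsym ξ hξ
      rw [hρe ξ (le_trans (by norm_num) (hsupp ξ hξ)), Complex.real_smul, mul_right_comm,
        ← Complex.ofReal_mul, ← mul_pow, inv_mul_cancel₀ (by positivity), one_pow,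
        Complex.ofReal_one, one_mul]
    · rw [image_eq_zero_of_notMem_tsupport hξ, smul_zero, zero_mul]
  · rw [hk, ENNReal.ofReal]
    gcongr
    have h0 : 0 ≤ ∑ a ∈ s, D a.1 a.2 := Finset.sum_nonneg fun _ _ => hD0 _ _
    refine Seminorm.finset_sup_apply_le h0 fun a ha => ?_
    exact (hD a.1 a.2 i _ fun _ => rfl).trans
      (Finset.single_le_sum (f := fun a : ℕ × ℕ => D a.1 a.2) (fun _ _ => hD0 _ _) ha)

end Multipliers

/-! ### Supports and dilations of the dyadic resolution -/

section DyadicSupport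

open Filter Topology Set

variable {n : ℕ} {φ ψ : 𝓢(Rn n, ℂ)}

theorem IsDyadicResolution.tsupport_subset (h : IsDyadicResolution φ ψ) :
    tsupport (𝓕 φ : 𝓢(Rn n, ℂ)) ⊆ {ξ | 2⁻¹ ≤ ‖ξ‖ ∧ ‖ξ‖ ≤ 2} := by
  refine closure_minimal (fun ξ hξ => ?_)
    ((isClosed_le continuous_const continuous_norm).inter
      (isClosed_le continuous_norm continuous_const))
  by_contra hn
  exact hξ (h.eq_zero ξ fun hh => hn ⟨hh.1.le, hh.2.le⟩)

theorem IsDyadicResolution.hasCompactSupport (h : IsDyadicResolution φ ψ) :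
    HasCompactSupport (𝓕 φ : 𝓢(Rn n, ℂ)) :=
  (isCompact_closedBall (0 : Rn n) 2).of_isClosed_subset (isClosed_tsupport _) fun ξ hξ => by
    simpa using (h.tsupport_subset hξ).2

/-- For `‖ξ‖ ≥ 2` the terms with `j ≤ 0` are evaluated outside the annulus, so the terms with `j ≥
1` already sum to `1`. -/
theorem IsDyadicResolution.low_eq_zero (h : IsDyadicResolution φ ψ) {ξ : Rn n} (hξ : 2 ≤ ‖ξ‖) :
    𝓕 ψ ξ = 0 := by
  have h0 : ξ ≠ 0 := fun h0 => by rw [h0, norm_zero] at hξ; linarith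
  have hinj : Function.Injective fun j : ℕ => (j : ℤ) + 1 := fun a b hab => by simpa using hab
  have hs := (hinj.hasSum_iff (f := fun j : ℤ => 𝓕 φ ((2 : ℝ) ^ (-j) • ξ)) (a := 1) fun j hj => by
    refine h.eq_zero _ fun hh => ?_
    have hj0 : j ≤ 0 := by
      by_contra hlt
      push Not at hlt
      exact hj ⟨(j - 1).toNat, by simp only; omega⟩
    have h1 : (1 : ℝ) ≤ (2 : ℝ) ^ (-j) := one_le_zpow₀ (by norm_num) (by omega)
    have h2 := hh.2
    rw [norm_smul, Real.norm_of_nonneg (by positivity)] at h2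
    nlinarith).2 (h.hasSum ξ h0)
  rw [h.low ξ]
  have : ∑' j : ℕ, 𝓕 φ ((2 : ℝ) ^ (-((j : ℤ) + 1)) • ξ) = 1 := hs.tsum_eq
  rw [this, sub_self]

theorem IsDyadicResolution.hasCompactSupport_low (h : IsDyadicResolution φ ψ) :
    HasCompactSupport (𝓕 ψ : 𝓢(Rn n, ℂ)) :=
  HasCompactSupport.intro (isCompact_closedBall (0 : Rn n) 2) fun ξ hξ => by
    refine h.low_eq_zero ?_
    simp only [Metric.mem_closedBall, dist_zero_right, not_le] at hξ
    exact hξ.le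

theorem dyadicPiece_apply (k : 𝓢(Rn n, ℂ)) (m : ℕ) (x : Rn n) :
    dyadicPiece k m x = (((2 : ℝ) ^ m) ^ n : ℝ) • k ((2 : ℝ) ^ m • x) := by
  have h1 : ∀ (h : 𝓢(Rn n, ℂ)) (y : Rn n), h y
      = ∫ ξ, Complex.exp ((2 * Real.pi * inner ℝ ξ y : ℝ) * Complex.I) • 𝓕 h ξ := by
    intro h y
    have h0 : 𝓕⁻ (𝓕 h) = h := FourierTransform.fourierInv_fourier_eq h
    conv_lhs => rw [← h0]
    rw [fourierInv_coe, Real.fourierInv_eq']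
  have h2 := Measure.integral_comp_smul (volume : Measure (Rn n))
    (fun ζ => Complex.exp ((2 * Real.pi * inner ℝ ζ ((2 : ℝ) ^ m • x) : ℝ) * Complex.I) • 𝓕 k ζ)
    ((2 : ℝ) ^ (-(m : ℤ)))
  rw [h1 (dyadicPiece k m) x, h1 k ((2 : ℝ) ^ m • x)]
  have h3 : |(((2 : ℝ) ^ (-(m : ℤ))) ^ Module.finrank ℝ (Rn n))⁻¹| = ((2 : ℝ) ^ m) ^ n := by
    rw [abs_of_pos (by positivity), finrank_euclideanSpace_fin, zpow_neg, inv_pow, inv_inv,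
      zpow_natCast]
  rw [h3] at h2
  rw [← h2]
  refine integral_congr_ae (Eventually.of_forall fun ξ => ?_)
  simp only [fourier_dyadicPiece]
  rw [real_inner_smul_left, real_inner_smul_right, ← mul_assoc ((2 : ℝ) ^ (-(m : ℤ))), zpow_neg,
    zpow_natCast, inv_mul_cancel₀ (by positivity), one_mul]

theorem lintegral_enorm_dyadicPiece (k : 𝓢(Rn n, ℂ)) (m : ℕ) :
    ∫⁻ x, ‖dyadicPiece k m x‖ₑ = ∫⁻ x, ‖k x‖ₑ := by
  rw [← ofReal_integral_norm_eq_lintegral_enorm (dyadicPiece k m).integrable,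
    ← ofReal_integral_norm_eq_lintegral_enorm k.integrable]
  congr 1
  simp_rw [dyadicPiece_apply, norm_smul]
  rw [integral_const_mul, Measure.integral_comp_smul volume (fun y => ‖k y‖) ((2 : ℝ) ^ m),
    finrank_euclideanSpace_fin, abs_of_pos (by positivity), Real.norm_of_nonneg (by positivity),
    smul_eq_mul, ← mul_assoc, mul_inv_cancel₀ (by positivity), one_mul]

end DyadicSupport

/-! ### Dilations of the time bump -/

section TimeScaling

open Filter Topology Set

/-- The dilate `4ᵐ η(4ᵐ t)`. -/
def timeDilate (η : ℝ → ℝ) (m : ℕ) (t : ℝ) : ℝ := 4 ^ m * η (4 ^ m * t)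

theorem contDiff_timeDilate {η : ℝ → ℝ} (hη : ContDiff ℝ ∞ η) (m : ℕ) :
    ContDiff ℝ ∞ (timeDilate η m) :=
  contDiff_const.mul (hη.comp (contDiff_const.mul contDiff_id))

theorem tsupport_timeDilate_subset {η : ℝ → ℝ} {a b : ℝ} (h : tsupport η ⊆ Icc a b) (m : ℕ) :
    tsupport (timeDilate η m) ⊆ Icc (a / 4 ^ m) (b / 4 ^ m) := by
  refine closure_minimal (fun t ht => ?_) isClosed_Icc
  have h1 := h (subset_tsupport _ (right_ne_zero_of_mul ht))
  constructor
  · rw [div_le_iff₀ (by positivity)]; linarith [h1.1]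
  · rw [le_div_iff₀ (by positivity)]; linarith [h1.2]

/-- Parabolic scaling: since the symbol is quadratic, contracting time by `4 ^ m` matches dilating
frequency by `2 ^ m`. -/
theorem laplaceWeight_timeDilate (η : ℝ → ℝ) (m : ℕ) (r : ℝ) :
    laplaceWeight (timeDilate η m) r = laplaceWeight η (r / 4 ^ m) := by
  have h := Measure.integral_comp_mul_left (fun t => η t * Real.exp (-t * (r / 4 ^ m)))
    ((4 : ℝ) ^ m)
  rw [abs_of_pos (by positivity), smul_eq_mul] at h
  rw [laplaceWeight, laplaceWeight, eq_comm, ← one_mul (∫ t, η t * _),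
    ← mul_inv_cancel₀ (show (4 : ℝ) ^ m ≠ 0 by positivity), mul_assoc, ← h, ← integral_const_mul]
  congr 1
  funext t
  rw [timeDilate, ← mul_assoc]
  congr 2
  field_simp

theorem enorm_timeDilate_le {η : ℝ → ℝ} (h0 : ∀ t, 0 ≤ η t) (h1 : ∀ t, η t ≤ 1) (m : ℕ) (t : ℝ) :
    ‖timeDilate η m t‖ₑ ≤ 4 ^ m := by
  rw [← ofReal_norm, timeDilate, Real.norm_of_nonneg (mul_nonneg (by positivity) (h0 _))]
  refine (ENNReal.ofReal_le_ofReal (mul_le_of_le_one_right (by positivity) (h1 _))).trans ?_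
  rw [ENNReal.ofReal_pow (by norm_num)]
  norm_num

theorem lintegral_timeDilate_le {η : ℝ → ℝ} (h0 : ∀ t, 0 ≤ η t) (h1 : ∀ t, η t ≤ 1) {a b : ℝ}
    (hab : b - a ≤ 1) (m : ℕ) :
    ∫⁻ t in Icc (a / 4 ^ m) (b / 4 ^ m), ‖timeDilate η m t‖ₑ ≤ 1 := by
  calc ∫⁻ t in Icc (a / 4 ^ m) (b / 4 ^ m), ‖timeDilate η m t‖ₑ
      ≤ ∫⁻ _ in Icc (a / 4 ^ m) (b / 4 ^ m), (4 : ℝ≥0∞) ^ m :=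
        lintegral_mono fun t => enorm_timeDilate_le h0 h1 m t
    _ = ENNReal.ofReal (4 ^ m * ((b - a) / 4 ^ m)) := by
        rw [lintegral_const, Measure.restrict_apply_univ, Real.volume_Icc, ← sub_div,
          ENNReal.ofReal_mul (by positivity), ENNReal.ofReal_pow (by norm_num)]
        norm_num
    _ ≤ 1 := by
        rw [mul_div_cancel₀ _ (by positivity)]
        exact ENNReal.ofReal_le_one.2 hab

/-- The endpoints have ratio `7/3 < 4`, so the supports of the dilates by powers of `4` are pairwise
disjoint. -/
theorem exists_timeBump {τ : ℝ} (hτ : 0 < τ) : ∃ η : ℝ → ℝ, ContDiff ℝ ∞ η ∧ (∀ t, 0 ≤ η t) ∧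
    (∀ t, η t ≤ 1) ∧ (∃ t, η t ≠ 0) ∧ tsupport η ⊆ Icc (3 * τ / 8) (7 * τ / 8) := by
  let b : ContDiffBump (5 * τ / 8 : ℝ) := ⟨τ / 8, τ / 4, by positivity, by linarith⟩
  refine ⟨b, b.contDiff, fun t => b.nonneg, fun t => b.le_one, ⟨5 * τ / 8, ?_⟩, ?_⟩
  · rw [b.one_of_mem_closedBall (Metric.mem_closedBall_self (by positivity))]
    exact one_ne_zero
  · rw [b.tsupport_eq, Real.closedBall_eq_Icc]
    refine Icc_subset_Icc ?_ ?_
    · change 3 * τ / 8 ≤ 5 * τ / 8 - τ / 4; linarith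
    · change 5 * τ / 8 + τ / 4 ≤ 7 * τ / 8; linarith

end TimeScaling

/-! ### Estimates at one dyadic level -/

section DyadicLevel

open Filter Topology Set

variable {n : ℕ} {T : ℝ≥0∞} {i : ℕ} {w : Rn n × ℝ → ℂ} {η : ℝ → ℝ} {a b : ℝ}
  {f : 𝓢'(Rn n, ℂ)} {k θ : 𝓢(Rn n, ℂ)}

/-- Transports the factorization at unit frequency to level `m`. Rescaling the symbol costs `4 ^ (-m
i)`, which is moved into the kernel, whose dilation preserves the `L¹` norm. -/
theorem fourier_dilate_eq {θm : 𝓢(Rn n, ℂ)} {m : ℕ}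
    (hk : ∀ ξ, 𝓕 θ ξ = 𝓕 k ξ *
      ((laplaceSymbol ξ ^ i * laplaceWeight η (laplaceSymbol ξ) : ℝ) : ℂ))
    (hθm : ∀ ξ, 𝓕 θm ξ = 𝓕 θ ((2 : ℝ) ^ (-(m : ℤ)) • ξ)) (ξ : Rn n) :
    𝓕 θm ξ = 𝓕 (((((4 : ℝ) ^ m) ^ i)⁻¹ : ℂ) • dyadicPiece k m) ξ *
      ((laplaceSymbol ξ ^ i * laplaceWeight (timeDilate η m) (laplaceSymbol ξ) : ℝ) : ℂ) := by
  have hsym : laplaceSymbol ((2 : ℝ) ^ (-(m : ℤ)) • ξ) = laplaceSymbol ξ / 4 ^ m := by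
    rw [laplaceSymbol, laplaceSymbol, norm_smul, Real.norm_of_nonneg (by positivity), mul_pow,
      zpow_neg, zpow_natCast, inv_pow, ← pow_mul, mul_comm m 2, pow_mul,
      show (2 : ℝ) ^ 2 = 4 by norm_num]
    field_simp
  rw [FourierTransform.fourier_smul, hθm, hk, hsym, laplaceWeight_timeDilate]
  change _ = ((((4 : ℝ) ^ m) ^ i)⁻¹ : ℂ) * 𝓕 (dyadicPiece k m) ξ * _
  rw [fourier_dyadicPiece]
  push_cast
  rw [div_pow]
  field_simp

theorem lintegral_enorm_smul_dyadicPiece (k : 𝓢(Rn n, ℂ)) (m i : ℕ) :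
    ∫⁻ x, ‖(((((4 : ℝ) ^ m) ^ i)⁻¹ : ℂ) • dyadicPiece k m) x‖ₑ
      = (((4 : ℝ≥0∞) ^ m) ^ i)⁻¹ * ∫⁻ x, ‖k x‖ₑ := by
  have h : ‖((((4 : ℝ) ^ m) ^ i)⁻¹ : ℂ)‖ₑ = (((4 : ℝ≥0∞) ^ m) ^ i)⁻¹ := by
    rw [enorm_inv (pow_ne_zero _ (pow_ne_zero _ (by norm_num))), enorm_pow, enorm_pow]
    congr 3
    rw [← ofReal_norm, Complex.norm_real]
    norm_num
  rw [← h, ← lintegral_enorm_dyadicPiece k m,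
    ← lintegral_const_mul _ (dyadicPiece k m).continuous.enorm.measurable]
  refine lintegral_congr fun x => ?_
  change ‖((((4 : ℝ) ^ m) ^ i)⁻¹ : ℂ) • dyadicPiece k m x‖ₑ = _
  rw [enorm_smul]

/-- The dyadic estimate for `p = ∞`. -/
theorem eLpNorm_top_dyadic_le (h : HasWeakDeriv (strip n T) 0 i (caloricExtension f) w)
    (hη : ContDiff ℝ ∞ η) (h0 : ∀ t, 0 ≤ η t) (h1 : ∀ t, η t ≤ 1) (ha : 0 < a)
    (hb0 : 0 ≤ b) (hb : ENNReal.ofReal b < T) (hab : b - a ≤ 1) (hsupp : tsupport η ⊆ Icc a b)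
    (hk : ∀ ξ, 𝓕 θ ξ = 𝓕 k ξ *
      ((laplaceSymbol ξ ^ i * laplaceWeight η (laplaceSymbol ξ) : ℝ) : ℂ))
    {m : ℕ} {θm : 𝓢(Rn n, ℂ)} (hθm : ∀ ξ, 𝓕 θm ξ = 𝓕 θ ((2 : ℝ) ^ (-(m : ℤ)) • ξ)) :
    eLpNorm (convDist θm f) ⊤ volume ≤ (((4 : ℝ≥0∞) ^ m) ^ i)⁻¹ * (∫⁻ x, ‖k x‖ₑ) *
      eLpNorm w ⊤ (volume.restrict (strip n T)) := by
  have hb' : ENNReal.ofReal (b / 4 ^ m) < T := lt_of_le_of_lt (ENNReal.ofReal_le_ofReal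
    (div_le_self hb0 (one_le_pow₀ (by norm_num)))) hb
  refine (eLpNorm_top_convDist_le h (contDiff_timeDilate hη m) (by positivity) hb'
    (tsupport_timeDilate_subset hsupp m) (fourier_dilate_eq hk hθm)).trans ?_
  rw [lintegral_enorm_smul_dyadicPiece]
  exact mul_le_mul' (mul_le_of_le_one_right' (lintegral_timeDilate_le h0 h1 hab m)) le_rfl

/-- The dyadic estimate for `p < ∞`. -/
theorem lintegral_dyadic_rpow_le (h : HasWeakDeriv (strip n T) 0 i (caloricExtension f) w)
    (hη : ContDiff ℝ ∞ η) (h0 : ∀ t, 0 ≤ η t) (h1 : ∀ t, η t ≤ 1) (ha : 0 < a)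
    (hb0 : 0 ≤ b) (hb : ENNReal.ofReal b < T) (hab : b - a ≤ 1) (hsupp : tsupport η ⊆ Icc a b)
    (hk : ∀ ξ, 𝓕 θ ξ = 𝓕 k ξ *
      ((laplaceSymbol ξ ^ i * laplaceWeight η (laplaceSymbol ξ) : ℝ) : ℂ))
    {m : ℕ} {θm : 𝓢(Rn n, ℂ)} (hθm : ∀ ξ, 𝓕 θm ξ = 𝓕 θ ((2 : ℝ) ^ (-(m : ℤ)) • ξ))
    {q : ℝ} (hq : 1 ≤ q) :
    ∫⁻ x, ‖convDist θm f x‖ₑ ^ q ≤ ((((4 : ℝ≥0∞) ^ m) ^ i)⁻¹ * ∫⁻ x, ‖k x‖ₑ) ^ q *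
      (4 ^ m * ∫⁻ z, ‖w z‖ₑ ^ q ∂(slabMeasure n (a / 4 ^ m) (b / 4 ^ m))) := by
  have hb' : ENNReal.ofReal (b / 4 ^ m) < T := lt_of_le_of_lt (ENNReal.ofReal_le_ofReal
    (div_le_self hb0 (one_le_pow₀ (by norm_num)))) hb
  refine (lintegral_convDist_rpow_le h (contDiff_timeDilate hη m) (by positivity) hb'
    (tsupport_timeDilate_subset hsupp m) (fourier_dilate_eq hk hθm) hq
    (enorm_timeDilate_le h0 h1 m)).trans ?_
  rw [lintegral_enorm_smul_dyadicPiece]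
  set A := (((4 : ℝ≥0∞) ^ m) ^ i)⁻¹ * ∫⁻ x, ‖k x‖ₑ
  -- The integral of the dilated bump is at most `1`, which leaves `A ^ (q - 1) * A = A ^ q`; the
  -- factor `4 ^ m` is the sup bound of the bump.
  calc _ ≤ A ^ (q - 1) * (A * _) := by
        refine mul_le_mul_left ?_ _
        exact ENNReal.rpow_le_rpow (mul_le_of_le_one_right'
          (lintegral_timeDilate_le h0 h1 hab m)) (by linarith)
    _ = _ := by
        rw [← mul_assoc]
        congr 1
        conv_lhs => rw [← ENNReal.rpow_one A, ← ENNReal.rpow_mul]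
        rw [← ENNReal.rpow_add_of_nonneg _ _ (by linarith) (by linarith)]
        congr 1
        ring

end DyadicLevel

/-! ### Summation over dyadic levels and the trace estimate -/

section Trace

open Filter Topology Set

theorem dyadic_weight_top (i m : ℕ) :
    (2 : ℝ≥0∞) ^ (2 * (i : ℝ) * m) * (((4 : ℝ≥0∞) ^ m) ^ i)⁻¹ = 1 := by
  have h : (2 : ℝ≥0∞) ^ (2 * (i : ℝ) * m) = ((4 : ℝ≥0∞) ^ m) ^ i := by
    rw [← pow_mul, show (4 : ℝ≥0∞) = 2 ^ 2 by norm_num, ← pow_mul, ← ENNReal.rpow_natCast]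
    congr 1
    push_cast
    ring
  rw [h]
  exact ENNReal.mul_inv_cancel (by simp) (by simp)

/-- This cancellation singles out the smoothness `2i - 2/q`: the part `2i` offsets the `i` time
derivatives, and `-2/q` offsets the height `4 ^ m` of the bump. -/
theorem dyadic_weight_rpow (i m : ℕ) {q : ℝ} (hq : 0 < q) :
    ((2 : ℝ≥0∞) ^ ((2 * (i : ℝ) - 2 * q⁻¹) * m)) ^ q *
      (((((4 : ℝ≥0∞) ^ m) ^ i)⁻¹) ^ q * 4 ^ m) = 1 := by
  have h4 : ∀ l : ℕ, (4 : ℝ≥0∞) ^ l = 2 ^ (2 * (l : ℝ)) := fun l => by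
    rw [show (4 : ℝ≥0∞) = 2 ^ 2 by norm_num, ← pow_mul, ← ENNReal.rpow_natCast]
    congr 1
    push_cast
    ring
  rw [← pow_mul, h4, h4, ← ENNReal.rpow_neg, ← ENNReal.rpow_mul, ← ENNReal.rpow_mul,
    ← ENNReal.rpow_add _ _ (by simp) (by simp), ← ENNReal.rpow_add _ _ (by simp) (by simp)]
  convert ENNReal.rpow_zero using 2
  push_cast
  field_simp
  ring

/-- Disjoint dyadic slabs fill at most the strip. -/
theorem tsum_lintegral_slabMeasure_le {n : ℕ} {T : ℝ≥0∞} {a b : ℝ} (ha : 0 < a) (hb0 : 0 ≤ b)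
    (hb : ENNReal.ofReal b < T) (hab : b < 4 * a) (F : Rn n × ℝ → ℝ≥0∞) :
    ∑' j : ℕ, ∫⁻ z, F z ∂(slabMeasure n (a / 4 ^ (j + 1)) (b / 4 ^ (j + 1)))
      ≤ ∫⁻ z in strip n T, F z := by
  simp_rw [slabMeasure_eq_restrict]
  rw [← lintegral_iUnion (fun j => MeasurableSet.univ.prod measurableSet_Icc)]
  · refine lintegral_mono_set (iUnion_subset fun j => slab_subset_strip (by positivity) ?_)
    exact lt_of_le_of_lt (ENNReal.ofReal_le_ofReal
      (div_le_self hb0 (one_le_pow₀ (by norm_num)))) hb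
  · refine (pairwise_disjoint_on _).2 fun j k hjk => ?_
    rw [Set.disjoint_left]
    rintro z ⟨-, hz⟩ ⟨-, hz'⟩
    -- By `b < 4 * a`, the slab at the finer level `k` ends before the slab at level `j` begins.
    have h1 : b / 4 ^ (k + 1) < a / 4 ^ (j + 1) := by
      rw [div_lt_div_iff₀ (by positivity) (by positivity)]
      have h2 : (4 : ℝ) ^ (j + 1) * 4 ≤ 4 ^ (k + 1) := by
        rw [← pow_succ]
        exact pow_le_pow_right₀ (by norm_num) (by omega)
      have h3 : (0 : ℝ) < 4 ^ (j + 1) := by positivity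
      nlinarith
    linarith [hz.1, hz'.2]

variable {n : ℕ} {T : ℝ≥0∞} {i : ℕ} {w : Rn n × ℝ → ℂ} {η : ℝ → ℝ} {a b : ℝ}
  {f : 𝓢'(Rn n, ℂ)} {k θ : 𝓢(Rn n, ℂ)}

theorem eLpNorm_eq_lintegral_rpow {α : Type*} [MeasurableSpace α] {μ : Measure α} {p : ℝ≥0∞}
    (hp : 1 ≤ p) (hp' : p ≠ ⊤) (g : α → ℂ) :
    eLpNorm g p μ = (∫⁻ x, ‖g x‖ₑ ^ p.toReal ∂μ) ^ (1 / p.toReal) :=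
  eLpNorm_eq_lintegral_rpow_enorm_toReal (zero_lt_one.trans_le hp).ne' hp'

/-- The low frequency estimate. -/
theorem eLpNorm_convDist_low_le (h : HasWeakDeriv (strip n T) 0 0 (caloricExtension f) w)
    (hη : ContDiff ℝ ∞ η) (h0 : ∀ t, 0 ≤ η t) (h1 : ∀ t, η t ≤ 1) (ha : 0 < a)
    (hb0 : 0 ≤ b) (hb : ENNReal.ofReal b < T) (hab : b - a ≤ 1) (hsupp : tsupport η ⊆ Icc a b)
    (hk : ∀ ξ, 𝓕 θ ξ = 𝓕 k ξ * ((laplaceWeight η (laplaceSymbol ξ) : ℝ) : ℂ))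
    {p : ℝ≥0∞} (hp : 1 ≤ p) :
    eLpNorm (convDist θ f) p volume
      ≤ (∫⁻ x, ‖k x‖ₑ) * eLpNorm w p (volume.restrict (strip n T)) := by
  have hk' : ∀ ξ, 𝓕 θ ξ = 𝓕 k ξ *
      ((laplaceSymbol ξ ^ 0 * laplaceWeight η (laplaceSymbol ξ) : ℝ) : ℂ) := by simpa using hk
  have hθ : ∀ ξ, 𝓕 θ ξ = 𝓕 θ ((2 : ℝ) ^ (-((0 : ℕ) : ℤ)) • ξ) := by simp
  rcases eq_or_ne p ⊤ with rfl | hp'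
  · simpa using eLpNorm_top_dyadic_le h hη h0 h1 ha hb0 hb hab hsupp hk' hθ
  · have hq : 1 ≤ p.toReal := by simpa using ENNReal.toReal_mono hp' hp
    have hq0 : 0 < p.toReal := by linarith
    rw [eLpNorm_eq_lintegral_rpow hp hp', eLpNorm_eq_lintegral_rpow hp hp', one_div,
      ENNReal.rpow_inv_le_iff hq0, ENNReal.mul_rpow_of_nonneg _ _ hq0.le,
      ENNReal.rpow_inv_rpow hq0.ne']
    refine (lintegral_dyadic_rpow_le h hη h0 h1 ha hb0 hb hab hsupp hk' hθ hq).trans ?_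
    simp only [pow_zero, div_one, inv_one, one_mul]
    exact mul_le_mul' le_rfl (lintegral_mono' (slabMeasure_le_restrict_strip ha hb) le_rfl)

/-- The high frequency estimate for `p = ∞`. -/
theorem iSup_dyadicPiece_le (h : HasWeakDeriv (strip n T) 0 i (caloricExtension f) w)
    (hη : ContDiff ℝ ∞ η) (h0 : ∀ t, 0 ≤ η t) (h1 : ∀ t, η t ≤ 1) (ha : 0 < a)
    (hb0 : 0 ≤ b) (hb : ENNReal.ofReal b < T) (hab : b - a ≤ 1) (hsupp : tsupport η ⊆ Icc a b)
    (hk : ∀ ξ, 𝓕 θ ξ = 𝓕 k ξ *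
      ((laplaceSymbol ξ ^ i * laplaceWeight η (laplaceSymbol ξ) : ℝ) : ℂ)) :
    (⨆ j : ℕ, (2 : ℝ≥0∞) ^ (2 * (i : ℝ) * ((j : ℝ) + 1)) *
        eLpNorm (convDist (dyadicPiece θ (j + 1)) f) ⊤ volume)
      ≤ (∫⁻ x, ‖k x‖ₑ) * eLpNorm w ⊤ (volume.restrict (strip n T)) := by
  refine iSup_le fun j => ?_
  have hw := dyadic_weight_top i (j + 1)
  rw [Nat.cast_add_one] at hw
  calc _ ≤ (2 : ℝ≥0∞) ^ (2 * (i : ℝ) * ((j : ℝ) + 1)) * ((((4 : ℝ≥0∞) ^ (j + 1)) ^ i)⁻¹ *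
        (∫⁻ x, ‖k x‖ₑ) * eLpNorm w ⊤ (volume.restrict (strip n T))) :=
        mul_le_mul' le_rfl (eLpNorm_top_dyadic_le h hη h0 h1 ha hb0 hb hab hsupp hk
          (fourier_dyadicPiece θ (j + 1)))
    _ = _ := by rw [← mul_assoc, ← mul_assoc, hw, one_mul]

/-- The high frequency estimate for `p < ∞`. -/
theorem tsum_dyadicPiece_le (h : HasWeakDeriv (strip n T) 0 i (caloricExtension f) w)
    (hη : ContDiff ℝ ∞ η) (h0 : ∀ t, 0 ≤ η t) (h1 : ∀ t, η t ≤ 1) (ha : 0 < a)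
    (hb0 : 0 ≤ b) (hb : ENNReal.ofReal b < T) (hab : b - a ≤ 1) (hab' : b < 4 * a)
    (hsupp : tsupport η ⊆ Icc a b)
    (hk : ∀ ξ, 𝓕 θ ξ = 𝓕 k ξ *
      ((laplaceSymbol ξ ^ i * laplaceWeight η (laplaceSymbol ξ) : ℝ) : ℂ))
    {p : ℝ≥0∞} (hp : 1 ≤ p) (hp' : p ≠ ⊤) :
    (∑' j : ℕ, ((2 : ℝ≥0∞) ^ ((2 * (i : ℝ) - 2 * p⁻¹.toReal) * ((j : ℝ) + 1)) *
        eLpNorm (convDist (dyadicPiece θ (j + 1)) f) p volume) ^ p.toReal) ^ (1 / p.toReal)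
      ≤ (∫⁻ x, ‖k x‖ₑ) * eLpNorm w p (volume.restrict (strip n T)) := by
  have hq : 1 ≤ p.toReal := by simpa using ENNReal.toReal_mono hp' hp
  have hq0 : 0 < p.toReal := by linarith
  simp_rw [eLpNorm_eq_lintegral_rpow hp hp', ENNReal.toReal_inv, one_div]
  rw [ENNReal.rpow_inv_le_iff hq0, ENNReal.mul_rpow_of_nonneg _ _ hq0.le,
    ENNReal.rpow_inv_rpow hq0.ne']
  refine le_trans ?_ (mul_le_mul' le_rfl
    (tsum_lintegral_slabMeasure_le ha hb0 hb hab' fun z => ‖w z‖ₑ ^ p.toReal))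
  rw [← ENNReal.tsum_mul_left]
  refine ENNReal.tsum_le_tsum fun j => ?_
  have hw := dyadic_weight_rpow i (j + 1) hq0
  rw [Nat.cast_add_one] at hw
  rw [ENNReal.mul_rpow_of_nonneg _ _ hq0.le, ENNReal.rpow_inv_rpow hq0.ne']
  refine (mul_le_mul' le_rfl (lintegral_dyadic_rpow_le h hη h0 h1 ha hb0 hb hab hsupp hk
    (fourier_dyadicPiece θ (j + 1)) hq)).trans_eq ?_
  rw [ENNReal.mul_rpow_of_nonneg _ _ hq0.le]
  set S := ∫⁻ z, ‖w z‖ₑ ^ p.toReal ∂(slabMeasure n (a / 4 ^ (j + 1)) (b / 4 ^ (j + 1)))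
  set K := (∫⁻ x, ‖k x‖ₑ) ^ p.toReal
  rw [← one_mul (K * S), ← hw]
  ring

theorem exists_fourier_eq_mul_laplaceWeight (h : 𝓢(Rn n, ℂ)) (hh : HasCompactSupport h)
    (hη : Continuous η) (hc : HasCompactSupport η) (h0 : ∀ t, 0 ≤ η t) {t₀ : ℝ} (ht₀ : η t₀ ≠ 0) :
    ∃ g : 𝓢(Rn n, ℂ), tsupport g ⊆ tsupport h ∧
      ∀ ξ, h ξ = g ξ * ((laplaceWeight η (laplaceSymbol ξ) : ℝ) : ℂ) :=
  exists_schwartz_eq_mul h hh ((contDiff_laplaceWeight hη hc).comp contDiff_laplaceSymbol)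
    fun _ => (laplaceWeight_pos hη hc h0 ht₀ _).ne'

theorem exists_time_lt {T : ℝ≥0∞} (hT : 0 < T) :
    ∃ τ : ℝ, 0 < τ ∧ τ ≤ 1 ∧ ENNReal.ofReal τ ≤ T := by
  refine ⟨(min 1 T).toReal, ENNReal.toReal_pos (by simp [hT.ne']) (by simp), ?_, ?_⟩
  · simpa using ENNReal.toReal_mono ENNReal.one_ne_top (min_le_left 1 T)
  · rw [ENNReal.ofReal_toReal (by simp)]
    exact min_le_right 1 T

/-- Kernel data for the estimates: a bump in time, and kernels which recover the
low and high frequency parts of a distribution from time averages of its caloric extension. -/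
theorem exists_kernels {φ ψ : 𝓢(Rn n, ℂ)} (hφψ : IsDyadicResolution φ ψ) (hT : 0 < T) :
    ∃ (η : ℝ → ℝ) (a b : ℝ) (A B : ℝ≥0), ContDiff ℝ ∞ η ∧ (∀ t, 0 ≤ η t) ∧ (∀ t, η t ≤ 1) ∧
      0 < a ∧ 0 ≤ b ∧ ENNReal.ofReal b < T ∧ b - a ≤ 1 ∧ b < 4 * a ∧ tsupport η ⊆ Icc a b ∧
      (∃ k : 𝓢(Rn n, ℂ), (∀ ξ, 𝓕 ψ ξ = 𝓕 k ξ *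
        ((laplaceWeight η (laplaceSymbol ξ) : ℝ) : ℂ)) ∧ ∫⁻ x, ‖k x‖ₑ ≤ A) ∧
      ∀ i : ℕ, ∃ k : 𝓢(Rn n, ℂ), (∀ ξ, 𝓕 φ ξ = 𝓕 k ξ *
        ((laplaceSymbol ξ ^ i * laplaceWeight η (laplaceSymbol ξ) : ℝ) : ℂ)) ∧
        ∫⁻ x, ‖k x‖ₑ ≤ B := by
  obtain ⟨τ, hτ, hτ1, hτT⟩ := exists_time_lt hT
  obtain ⟨η, hη, h0, h1, ⟨t₀, ht₀⟩, hsupp⟩ := exists_timeBump hτ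
  have hc : HasCompactSupport η := isCompact_Icc.of_isClosed_subset (isClosed_tsupport η) hsupp
  obtain ⟨g, -, hg⟩ := exists_fourier_eq_mul_laplaceWeight (𝓕 ψ) hφψ.hasCompactSupport_low
    hη.continuous hc h0 ht₀
  -- The Laplace weight does not depend on `i` and is divided out once; only then are the powers of
  -- the symbol removed, so a single `B` serves every `i`.
  obtain ⟨h, hsub, hh⟩ := exists_fourier_eq_mul_laplaceWeight (𝓕 φ) hφψ.hasCompactSupport
    hη.continuous hc h0 ht₀
  obtain ⟨B, hB⟩ := exists_fourier_eq_mul_laplaceSymbol_pow h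
    (hφψ.hasCompactSupport.of_isClosed_subset (isClosed_tsupport _) hsub)
    fun ξ hξ => (hφψ.tsupport_subset (hsub hξ)).1
  refine ⟨η, 3 * τ / 8, 7 * τ / 8, (∫⁻ x, ‖(𝓕⁻ g : 𝓢(Rn n, ℂ)) x‖ₑ).toNNReal, B, hη, h0, h1,
    by positivity, by positivity, ?_, by linarith, by linarith, hsupp, ⟨𝓕⁻ g, ?_, ?_⟩, ?_⟩
  · exact ((ENNReal.ofReal_lt_ofReal_iff hτ).2 (by linarith)).trans_le hτT
  · intro ξ
    rw [FourierTransform.fourier_fourierInv_eq]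
    exact hg ξ
  · rw [ENNReal.coe_toNNReal]
    exact ((𝓕⁻ g : 𝓢(Rn n, ℂ)).integrable (μ := volume)).2.ne
  · intro i
    obtain ⟨k, hk, hkB⟩ := hB i
    refine ⟨k, fun ξ => ?_, hkB⟩
    rw [hh ξ, hk ξ]
    push_cast
    ring

end Trace

theorem theorem5p5 (n : ℕ) (hn : 0 < n) (φ ψ : 𝓢(Rn n, ℂ)) (hφψ : IsDyadicResolution φ ψ)
    (p : ℝ≥0∞) (hp : 1 ≤ p) (T : ℝ≥0∞) (hT : 0 < T) :
    ∃ C : ℝ≥0, 0 < C ∧ ∀ (i : ℕ) (f : 𝓢'(Rn n, ℂ)),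
      besovNorm φ ψ (2 * (i : ℝ) - 2 * p⁻¹.toReal) p f < ⊤ →
        besovNorm φ ψ (2 * (i : ℝ) - 2 * p⁻¹.toReal) p f
          ≤ C * parabolicSobolevNorm i p T (caloricExtension f) := by
  obtain ⟨η, a, b, A, B, hη, h0, h1, ha, hb0, hb, hab, hab', hsupp, ⟨k, hk, hkA⟩, hB⟩ :=
    exists_kernels hφψ hT
  refine ⟨A + B + 1, by positivity, fun i f _ => ?_⟩
  obtain ⟨g, hg, hgB⟩ := hB i
  rw [parabolicSobolevNorm]
  -- Multiplication by a nonzero finite constant commutes with the infimum, so the bound is proved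
  -- for each admissible family `w` of weak derivatives.
  simp_rw [ENNReal.mul_iInf_of_ne (ENNReal.coe_ne_zero.2
    (show A + B + 1 ≠ 0 by positivity)) ENNReal.coe_ne_top]
  refine le_iInf₂ fun w hw => ?_
  -- Only two derivatives enter: `u` itself for the low frequencies and `D_t^i u` for the high ones.
  have hm0 : ((0 : Fin n → ℕ), 0) ∈ parabolicIndex n i := by simp [mem_parabolicIndex]
  have hmi : ((0 : Fin n → ℕ), i) ∈ parabolicIndex n i := by simp [mem_parabolicIndex]
  have hlow := (eLpNorm_convDist_low_le (hw _ hm0) hη h0 h1 ha hb0 hb hab hsupp hk hp).trans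
    (mul_le_mul' hkA le_rfl)
  have hAC : (A : ℝ≥0∞) ≤ ((A + B + 1 : ℝ≥0) : ℝ≥0∞) := by
    exact_mod_cast (le_self_add.trans le_self_add : A ≤ A + B + 1)
  have hBC : (B : ℝ≥0∞) ≤ ((A + B + 1 : ℝ≥0) : ℝ≥0∞) := by
    exact_mod_cast (le_add_self.trans le_self_add : B ≤ A + B + 1)
  rcases eq_or_ne p ⊤ with rfl | hp'
  · rw [besovNorm, if_pos rfl, if_pos rfl]
    have hle : ∀ c ∈ parabolicIndex n i, eLpNorm (w c) ⊤ (volume.restrict (strip n T)) ≤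
        ∑ c ∈ parabolicIndex n i, eLpNorm (w c) ⊤ (volume.restrict (strip n T)) := fun c hc =>
      Finset.single_le_sum (f := fun c => eLpNorm (w c) ⊤ (volume.restrict (strip n T)))
        (fun _ _ => zero_le) hc
    refine max_le (hlow.trans (mul_le_mul' hAC (hle _ hm0))) ?_
    simpa using (iSup_dyadicPiece_le (hw _ hmi) hη h0 h1 ha hb0 hb hab hsupp hg).trans
      (mul_le_mul' (hgB.trans hBC) (hle _ hmi))
  · rw [besovNorm, if_neg hp', if_neg hp']
    have hq0 : 0 < p.toReal := ENNReal.toReal_pos (zero_lt_one.trans_le hp).ne' hp'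
    set W := (∑ c ∈ parabolicIndex n i,
      eLpNorm (w c) p (volume.restrict (strip n T)) ^ p.toReal) ^ (1 / p.toReal)
    have hle : ∀ c ∈ parabolicIndex n i, eLpNorm (w c) p (volume.restrict (strip n T)) ≤ W := by
      intro c hc
      simp only [W, one_div]
      rw [ENNReal.le_rpow_inv_iff hq0]
      exact Finset.single_le_sum
        (f := fun c => eLpNorm (w c) p (volume.restrict (strip n T)) ^ p.toReal)
        (fun _ _ => zero_le) hc
    have hhigh := (tsum_dyadicPiece_le (hw _ hmi) hη h0 h1 ha hb0 hb hab hab' hsupp hg hp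
      hp').trans (mul_le_mul' hgB (hle _ hmi))
    calc _ ≤ (A : ℝ≥0∞) * W + B * W :=
          add_le_add (hlow.trans (mul_le_mul' le_rfl (hle _ hm0))) hhigh
      _ ≤ _ := by
          rw [← add_mul]
          refine mul_le_mul' ?_ le_rfl
          exact_mod_cast (le_self_add : A + B ≤ A + B + 1)
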